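/- Let $n\ge 2$, let $K$ be a field of characteristic $0$ and let $q^{1/4}\in K$ be nonzero and not a root of unity (for instance $K=\mathbf C(q^{1/4})$). Write $[x]=\frac{q^{x}-q^{-x}}{q-q^{-1}}$ and $[A,B]_v=AB-v\,BA$, $[A,B]=[A,B]_1$. Lattice. Let $P=\bigoplus_{i=1}^n\mathbf Z\varepsilon_i$ with $(\varepsilon_i|\varepsilon_j)=\frac12\delta_{ij}$, $\alpha_i=\varepsilon_i-\varepsilon_{i+1}$ ($i<n$), $\alpha_n=2\varepsilon_n$, $\lambda_i=\varepsilon_1+\dots+\varepsilon_i$. Fock space. Let $a_i(m),b_i(m)$ ($1\le i\le n$, $m\ne 0$) satisfy $$[a_i(m),a_j(l)]=\delta_{m+l,0}\frac{[m(\alpha_i|\alpha_j)]\,[-m/2]}{m},\qquad [b_i(m),b_j(l)]=m\,\delta_{ij}\delta_{m+l,0},\qquad [a_i(m),b_j(l)]=0 ,$$ and let $\widetilde{\mathcal F}=\bigoplus \mathcal F_{\alpha,\beta}$ over $\alpha\in P+\frac12\mathbf Z\lambda_n$, $\beta\in P$, where $\mathcal F_{\alpha,\beta}$ is the Fock space freely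 generated by the $a_i(-m),b_i(-m)$, $m>0$, from a vacuum $|\alpha,\beta\rangle$ killed by $a_i(m),b_i(m)$, $m>0$. On $\mathcal F_{\alpha,\beta}$ put $a_i(0)=(\alpha_i|\alpha)$, $b_i(0)=(2\varepsilon_i|\beta)$. For $\gamma\in P$ the operator $e^{\gamma}$ maps $|\alpha,\beta\rangle$ to $|\alpha+\gamma,\beta\rangle$, $e^{b_i}$ maps it to $|\alpha,\beta+\varepsilon_i\rangle$, and both commute with all modes of nonzero index. Currents. Put $\partial f(z)=\frac{f(q^{1/2}z)-f(q^{-1/2}z)}{(q^{1/2}-q^{-1/2})z}$, $$Y_i^{\pm}(z)=\exp\Bigl(\pm\sum_{k\ge1}\tfrac{a_i(-k)}{[-k/2]}q^{\pm k/4}z^k\Bigr)\exp\Bigl(\mp\sum_{k\ge1}\tfrac{a_i(k)}{[-k/2]}q^{\pm k/4}z^{-k}\Bigr)e^{\pm\alpha_i}z^{\mp2a_i(0)},$$ $$Z_i^{\pm}(z)=\exp\Bigl(\pm\sum_{k\ge1}\tfrac{b_i(-k)}{k}z^k\Bigr)\exp\Bigl(\mp\sum_{k\ge1}\tfrac{b_i(k)}{k}z^{-k}\Bigr)e^{\pm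 b_i}z^{\pm b_i(0)},$$ and, with $:\ :$ the normal ordering (creation operators and $e^{\gamma}$ to the left), $$X_i^+(z)=\partial Z_i^+(z)\,Z_{i+1}^-(z)\,Y_i^+(z),\qquad X_i^-(z)=Z_i^-(z)\,\partial Z_{i+1}^+(z)\,Y_i^-(z)\qquad(1\le i\le n-1),$$ $$X_n^+(z)=\Bigl(\tfrac1{q^{1/2}+q^{-1/2}}:Z_n^+(z)\partial^2Z_n^+(z):-:\partial Z_n^+(q^{1/2}z)\,\partial Z_n^+(q^{-1/2}z):\Bigr)Y_n^+(z),$$ $$X_n^-(z)=\tfrac1{q^{1/2}+q^{-1/2}}:Z_n^-(q^{1/2}z)Z_n^-(q^{-1/2}z):Y_n^-(z).$$ Write $X_i^\pm(z)=\sum_{m\in\mathbf Z}x_i^\pm(m)z^{-m-1}$. Vertex operator. For $m\neq0$ let $$a_{\bar1}(m)=\sum_{i=1}^{n-1}\frac{m}{[m/2]^2}\,\frac{[(n+1-i)m]}{[(n+1-i)m/2]}\,\frac{[(n+1)m/2]}{[(n+1)m]}\,a_i(m)+\frac{m}{[m/2]^2}\,\frac{[(n+1)m/2]}{[(n+1)m]}\,a_n(m),$$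 the combination with $[a_j(m),a_{\bar1}(l)]=\delta_{j1}\delta_{m,-l}$. Let $\mu$ be one of the classical weights $0$, $\lambda_1$, $-\frac12\lambda_n$, $-\frac32\lambda_n+\lambda_{n-1}$ (the classical parts of $\mu_1,\dots,\mu_4$), let $c\in K$ be a constant, let $\lambda_1(0)$ act on $\mathcal F_{\alpha,\beta}$ as $2(\lambda_1|\alpha)$, and let $$\Phi_{\bar1}(z)=c\,\exp\Bigl(\sum_{k\ge1}\tfrac{[k/2]}{k}q^{(n+1/4)k}a_{\bar1}(-k)z^k\Bigr)\exp\Bigl(\sum_{k\ge1}\tfrac{[k/2]}{k}q^{-(n+3/4)k}a_{\bar1}(k)z^{-k}\Bigr)e^{\lambda_1}\,(q^{n+1/2}z)^{-\lambda_1(0)+1-2(\lambda_1|\mu)}\;\partial_z\bigl(Z_1^+(q^{n+1/2}z)\bigr),$$ a formal series in $z^{\pm1/2}$ of operators on $\widetilde{\mathcal F}$. Proposition. As formal series in $z,w$ with coefficients in $\operatorname{End}(\widetilde{\mathcal F})$: $$[\Phi_{\bar1}(z),X_i^+(w)]=0\quad(1\le i\le n),\qquad [\Phi_{\bar1}(z),X_i^-(w)]=0\quad(2\le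 i\le n),$$ $$[\Phi_{\bar1}(z),X_1^-(w)]_{q^{-1/2}}=\frac zw\,q^n\,[\Phi_{\bar1}(z),X_1^-(w)]_{q^{1/2}} .$$ In particular $$[\Phi_{\bar1}(z),x_1^-(1)]_{q^{-1/2}}=z\,q^n\,[\Phi_{\bar1}(z),x_1^-(0)]_{q^{1/2}} .$$ -/

import Mathlib

namespace SpVertex

noncomputable section

/-! ### Lattice data of type `C_n`

Indices of simple roots run through `1, …, n`; the coordinate `k : Fin n` corresponds to the index
`k + 1`.  Elements of `P = ℤ ε_1 ⊕ ⋯ ⊕ ℤ ε_n` are written in the basis `ε_1, …, ε_n`. -/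

/-- `ε_i`. -/
def eps (n i : ℕ) : Fin n → ℤ := fun k => if (k : ℕ) + 1 = i then 1 else 0

/-- The simple roots `α_i = ε_i - ε_{i+1}` for `i < n` and `α_n = 2 ε_n`. -/
def root (n i : ℕ) : Fin n → ℤ := if i < n then eps n i - eps n (i + 1) else 2 • eps n n

/-- `λ_i = ε_1 + ⋯ + ε_i`. -/
def fundWt (n i : ℕ) : Fin n → ℤ := ∑ j ∈ Finset.Icc 1 i, eps n j

/-- The inclusion of `P` into its rational span. -/
def toRat {n : ℕ} (x : Fin n → ℤ) : Fin n → ℚ := fun k => (x k : ℚ)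

/-- The bilinear form with `(ε_i | ε_j) = δ_{ij} / 2`. -/
def form {n : ℕ} (x y : Fin n → ℚ) : ℚ := ∑ k, x k * y k / 2

/-- Labels of the sectors of the Fock space: the pairs `(α, β)` with `α ∈ P + ½ ℤ λ_n`, `β ∈ P`.
The triple `(h, x, y)` stands for `α = x` (if `h = false`) or `α = x + ½ λ_n` (if `h = true`),
and `β = y`. -/
abbrev Charge (n : ℕ) := Bool × (Fin n → ℤ) × (Fin n → ℤ)

/-- The weight `α` of a sector. -/
def Charge.al {n : ℕ} (w : Charge n) : Fin n → ℚ :=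
  toRat w.2.1 + (if w.1 then (1 / 2 : ℚ) else 0) • toRat (fundWt n n)

/-- The weight `β` of a sector. -/
def Charge.be {n : ℕ} (w : Charge n) : Fin n → ℚ := toRat w.2.2

/-- The classical parts of the four highest weights `μ_1 = -½Λ_0`, `μ_2 = -3/2 Λ_0 + Λ_1 - ½ δ`,
`μ_3 = -½ Λ_n`, `μ_4 = -3/2 Λ_n + Λ_{n-1}` (numbered `0, 1, 2, 3`). -/
def mu (n : ℕ) : Fin 4 → (Fin n → ℚ) :=
  ![0, toRat (fundWt n 1), (-1 / 2 : ℚ) • toRat (fundWt n n),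
    (-3 / 2 : ℚ) • toRat (fundWt n n) + toRat (fundWt n (n - 1))]

section Field

variable {K : Type*} [Field K]

/-- `q ^ x` for `x ∈ ¼ ℤ`, where `p = q ^ (1/4)`. -/
def qpow (p : K) (x : ℚ) : K := p ^ ⌊4 * x⌋

/-- `[x] = (q ^ x - q ^ (-x)) / (q - q⁻¹)`. -/
def qnum (p : K) (x : ℚ) : K := (qpow p x - qpow p (-x)) / (qpow p 1 - qpow p (-1))

end Field

/-! ### The Fock space -/

/-- Variables of the Fock space: `inl (i, k)` is `a_{i+1}(-k)`, `inr (i, k)` is `b_{i+1}(-k)`. -/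
abbrev Var (n : ℕ) := (Fin n × ℕ+) ⊕ (Fin n × ℕ+)

/-- One sector `F_{α, β}`: polynomials in the creation operators applied to `|α, β⟩`. -/
abbrev Sector (n : ℕ) (K : Type*) [Field K] := MvPolynomial (Var n) K

/-- The Fock space, the direct sum of the sectors `F_{α, β}` over all `(α, β)`;
the vacuum vector `|α, β⟩` is `Finsupp.single (α, β) 1`. -/
abbrev Fock (n : ℕ) (K : Type*) [Field K] := Charge n →₀ Sector n K

section Modes

variable {n : ℕ} {K : Type*} [Field K]

/-- The action of `a_{i+1}(-k)`, `k > 0`, on a sector. -/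
def aNeg (i : Fin n) (k : ℕ+) : Module.End K (Sector n K) :=
  LinearMap.mulLeft K (MvPolynomial.X (Sum.inl (i, k)))

/-- The action of `b_{i+1}(-k)`, `k > 0`, on a sector. -/
def bNeg (i : Fin n) (k : ℕ+) : Module.End K (Sector n K) :=
  LinearMap.mulLeft K (MvPolynomial.X (Sum.inr (i, k)))

/-- The action of `a_{i+1}(k)`, `k > 0`, on a sector: it kills the vacuum vector and
`[a_i(k), a_j(-l)] = δ_{kl} [k (α_i | α_j)] [-k/2] / k`. -/
def aPos (p : K) (i : Fin n) (k : ℕ+) : Module.End K (Sector n K) :=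
  ∑ j : Fin n,
    (qnum p ((k : ℕ) * form (toRat (root n ((i : ℕ) + 1))) (toRat (root n ((j : ℕ) + 1)))) *
        qnum p (-((k : ℕ) : ℚ) / 2) / ((k : ℕ) : K)) •
      (MvPolynomial.pderiv (Sum.inl (j, k)) : Derivation K (Sector n K) (Sector n K)).toLinearMap

/-- The action of `b_{i+1}(k)`, `k > 0`, on a sector: it kills the vacuum vector and
`[b_i(k), b_j(-l)] = k δ_{ij} δ_{kl}`. -/
def bPos (i : Fin n) (k : ℕ+) : Module.End K (Sector n K) :=
  ((k : ℕ) : K) •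
    (MvPolynomial.pderiv (Sum.inr (i, k)) : Derivation K (Sector n K) (Sector n K)).toLinearMap

end Modes

/-! ### Normally ordered exponentials -/

/-- The coefficient of `z ^ N` in `exp (∑_{k ≥ 1} A k z ^ k)`. -/
def expCoeff {K R : Type*} [Field K] [Ring R] [Algebra K R] (A : ℕ+ → R) (N : ℕ) : R :=
  ∑ j ∈ Finset.range (N + 1), ((j.factorial : K)⁻¹) •
    PowerSeries.coeff N ((PowerSeries.mk fun m => if h : 0 < m then A (m.toPNat h) else 0) ^ j)

/-- The data of a normally ordered exponential operator
`exp (∑_{k ≥ 1} ∑_i (creA k i a_i(-k) + creB k i b_i(-k)) z ^ k)`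
`exp (∑_{k ≥ 1} ∑_i (annA k i a_i(k) + annB k i b_i(k)) z ^ (-k))`
`e ^ (shA, shB) · Z`, where the zero-mode factor `Z` multiplies the sector with label `w` by
`scal w · z ^ (pow w)`, and `e ^ (shA, shB)` maps `|α, β⟩` to `|α + shA, β + shB⟩`. -/
@[ext]
structure NExp (n : ℕ) (K : Type*) where
  creA : ℕ+ → Fin n → K
  creB : ℕ+ → Fin n → K
  annA : ℕ+ → Fin n → K
  annB : ℕ+ → Fin n → K
  shA : Fin n → ℤ
  shB : Fin n → ℤ
  scal : Charge n → K
  pow : Charge n → ℚ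

/-- A formal series `A(z) = ∑_r A_r z ^ r` of operators on the Fock space;
`A r` is the coefficient of `z ^ r`. -/
abbrev Series (n : ℕ) (K : Type*) [Field K] := ℚ → Module.End K (Fock n K)

namespace NExp

variable {n : ℕ} {K : Type*} [Field K]

/-- The normally ordered product of two exponentials in the same variable: creation operators and
`e ^ γ` to the left, annihilation operators and `z ^ (zero mode)` to the right.  It is the ordinary
product whenever the modes occurring in the two factors commute. -/
instance : Mul (NExp n K) where
  mul V W :=
    { creA := V.creA + W.creA, creB := V.creB + W.creB
      annA := V.annA + W.annA, annB := V.annB + W.annB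
      shA := V.shA + W.shA, shB := V.shB + W.shB
      scal := V.scal * W.scal, pow := V.pow + W.pow }

/-- `∑_i (creA k i a_i(-k) + creB k i b_i(-k))`. -/
def creMode (V : NExp n K) (k : ℕ+) : Module.End K (Sector n K) :=
  ∑ i, (V.creA k i • aNeg i k + V.creB k i • bNeg i k)

/-- `∑_i (annA k i a_i(k) + annB k i b_i(k))`. -/
def annMode (p : K) (V : NExp n K) (k : ℕ+) : Module.End K (Sector n K) :=
  ∑ i, (V.annA k i • aPos p i k + V.annB k i • bPos i k)

end NExp

/-! The annihilation exponential is locally finite: on a given vector only finitely many of its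
coefficients are nonzero. -/

section LocallyFinite

variable {n : ℕ} {K : Type*} [Field K]

/-- The degree of a monomial, where `a_i(-k)` and `b_i(-k)` have degree `k`. -/
def degOf : (Var n →₀ ℕ) →+ ℕ :=
  Finsupp.weight (Sum.elim (fun x => (x.2 : ℕ)) (fun x => (x.2 : ℕ)))

/-- The span of the monomials of degree at most `M`. -/
def degLE (n : ℕ) (K : Type*) [Field K] (M : ℤ) : Submodule K (Sector n K) :=
  Submodule.span K {f | ∃ s : Var n →₀ ℕ, (degOf s : ℤ) ≤ M ∧ f = MvPolynomial.monomial s 1}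

/-- The operator `T` lowers the degree by at least `d`. -/
def Lowers (d : ℕ) (T : Module.End K (Sector n K)) : Prop :=
  ∀ M : ℤ, ∀ f ∈ degLE n K M, T f ∈ degLE n K (M - d)

theorem Lowers.zero (d : ℕ) : Lowers d (0 : Module.End K (Sector n K)) :=
  fun _ _ _ => Submodule.zero_mem _

theorem Lowers.one : Lowers 0 (1 : Module.End K (Sector n K)) := by
  intro M f hf
  simpa using hf

theorem Lowers.add {d : ℕ} {S T : Module.End K (Sector n K)} (hS : Lowers d S) (hT : Lowers d T) :
    Lowers d (S + T) :=
  fun M f hf => Submodule.add_mem _ (hS M f hf) (hT M f hf)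

theorem Lowers.smul {d : ℕ} (c : K) {T : Module.End K (Sector n K)} (hT : Lowers d T) :
    Lowers d (c • T) :=
  fun M f hf => Submodule.smul_mem _ c (hT M f hf)

theorem Lowers.sum {d : ℕ} {ι : Type*} (s : Finset ι) {T : ι → Module.End K (Sector n K)}
    (hT : ∀ i ∈ s, Lowers d (T i)) : Lowers d (∑ i ∈ s, T i) := by
  intro M f hf
  rw [LinearMap.sum_apply]
  exact Submodule.sum_mem _ fun i hi => hT i hi M f hf

theorem Lowers.mul {d e : ℕ} {S T : Module.End K (Sector n K)} (hS : Lowers d S)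
    (hT : Lowers e T) : Lowers (d + e) (S * T) := by
  intro M f hf
  have h := hS _ _ (hT M f hf)
  have hM : M - (e : ℤ) - (d : ℤ) = M - ((d + e : ℕ) : ℤ) := by push_cast; ring
  rw [hM] at h
  exact h

theorem lowers_pderiv (v : Var n) (d : ℕ)
    (hd : degOf (Finsupp.single v 1) = d) :
    Lowers d (MvPolynomial.pderiv v : Derivation K (Sector n K) (Sector n K)).toLinearMap := by
  intro M f hf
  induction hf using Submodule.span_induction with
  | zero => rw [map_zero]; exact Submodule.zero_mem _
  | add x y _ _ hx hy => rw [map_add]; exact Submodule.add_mem _ hx hy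
  | smul a x _ hx => rw [map_smul]; exact Submodule.smul_mem _ a hx
  | mem x hx =>
    obtain ⟨s, hs, rfl⟩ := hx
    change MvPolynomial.pderiv v (MvPolynomial.monomial s 1) ∈ _
    rw [MvPolynomial.pderiv_monomial]
    by_cases h0 : s v = 0
    · simp [h0]
    · have hs' : s = (s - Finsupp.single v 1) + Finsupp.single v 1 := by
        ext u
        by_cases hu : v = u
        · subst hu; simp; omega
        · simp [hu]
      have hdeg : degOf s = degOf (s - Finsupp.single v 1) + d := by
        conv_lhs => rw [hs']
        rw [map_add, hd]
      have : MvPolynomial.monomial (s - Finsupp.single v 1) ((1 : K) * (s v : K)) =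
          (s v : K) • MvPolynomial.monomial (s - Finsupp.single v 1) (1 : K) := by
        rw [MvPolynomial.smul_monomial]; simp
      rw [this]
      refine Submodule.smul_mem _ _ (Submodule.subset_span ⟨_, ?_, rfl⟩)
      omega

theorem lowers_annMode (p : K) (V : NExp n K) (k : ℕ+) : Lowers (k : ℕ) (V.annMode p k) := by
  refine Lowers.sum _ fun i _ => Lowers.add (Lowers.smul _ ?_) (Lowers.smul _ ?_)
  · refine Lowers.sum _ fun j _ => Lowers.smul _ (lowers_pderiv _ _ ?_)
    simp [degOf, Finsupp.weight_single]
  · refine Lowers.smul _ (lowers_pderiv _ _ ?_)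
    simp [degOf, Finsupp.weight_single]

theorem lowers_expCoeff (A : ℕ+ → Module.End K (Sector n K)) (hA : ∀ k : ℕ+, Lowers (k : ℕ) (A k))
    (N : ℕ) : Lowers N (expCoeff (K := K) A N) := by
  refine Lowers.sum _ fun j hj => Lowers.smul _ ?_
  clear hj
  induction j generalizing N with
  | zero =>
    rw [pow_zero, PowerSeries.coeff_one]
    split_ifs with h
    · subst h; exact Lowers.one
    · exact Lowers.zero _
  | succ j ih =>
    rw [pow_succ, PowerSeries.coeff_mul]
    refine Lowers.sum _ fun x hx => ?_
    rw [← Finset.HasAntidiagonal.mem_antidiagonal.mp hx]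
    refine Lowers.mul (ih _) ?_
    rw [PowerSeries.coeff_mk]
    split_ifs with h
    · exact hA (x.2.toPNat h)
    · exact Lowers.zero _

theorem exists_mem_degLE (f : Sector n K) : ∃ M : ℕ, f ∈ degLE n K M := by
  refine ⟨∑ s ∈ f.support, degOf s, ?_⟩
  rw [MvPolynomial.as_sum f]
  refine Submodule.sum_mem _ fun s hs => ?_
  have : MvPolynomial.monomial s (f.coeff s) = f.coeff s • MvPolynomial.monomial s (1 : K) := by
    rw [MvPolynomial.smul_monomial]; simp
  rw [this]
  refine Submodule.smul_mem _ _ (Submodule.subset_span ⟨s, ?_, rfl⟩)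
  rw [← MvPolynomial.as_sum f]
  exact_mod_cast Finset.single_le_sum (f := fun s => degOf s) (fun _ _ => Nat.zero_le _) hs

theorem annExp_eventually_zero (p : K) (V : NExp n K) (f : Sector n K) :
    ∃ M : ℕ, ∀ k, M < k → expCoeff (K := K) (V.annMode p) k f = 0 := by
  obtain ⟨M, hM⟩ := exists_mem_degLE f
  refine ⟨M, fun k hk => ?_⟩
  have h := lowers_expCoeff _ (lowers_annMode p V) k _ _ hM
  have hbot : degLE n K ((M : ℤ) - (k : ℤ)) = ⊥ := by
    rw [degLE, Submodule.span_eq_bot]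
    rintro _ ⟨s, hs, -⟩
    omega
  rw [hbot] at h
  simpa using h

end LocallyFinite

namespace NExp

variable {n : ℕ} {K : Type*} [Field K]

/-- The term of index `(j, k)` in the coefficient of `z ^ d` in the product of the creation
exponential and the annihilation exponential: it is present if `j - k = d`. -/
def oscTerm (p : K) (V : NExp n K) (d : ℚ) (x : ℕ × ℕ) : Module.End K (Sector n K) :=
  if (x.1 : ℚ) - (x.2 : ℚ) = d then
    expCoeff (K := K) V.creMode x.1 * expCoeff (K := K) (V.annMode p) x.2
  else 0

theorem oscTerm_finite (p : K) (V : NExp n K) (d : ℚ) (f : Sector n K) :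
    (Function.support fun x => V.oscTerm p d x f).Finite := by
  obtain ⟨M, hM⟩ := annExp_eventually_zero p V f
  refine Set.Finite.of_finite_image (f := Prod.snd) ((Set.finite_Iic M).subset ?_) ?_
  · rintro _ ⟨x, hx, rfl⟩
    by_contra hlt
    refine hx ?_
    have : expCoeff (K := K) (V.annMode p) x.2 f = 0 := hM _ (by simpa using hlt)
    simp only [oscTerm]
    split_ifs
    · rw [Module.End.mul_apply, this, map_zero]
    · rfl
  · have key : ∀ x, x ∈ Function.support (fun x => V.oscTerm p d x f) →
        (x.1 : ℚ) - (x.2 : ℚ) = d := by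
      intro x hx
      by_contra hne
      exact hx (by simp [oscTerm, hne])
    intro x hx y hy hxy
    have h1 := key x hx
    have h2 := key y hy
    have h3 : (x.1 : ℚ) = y.1 := by
      have : (x.2 : ℚ) = y.2 := by exact_mod_cast hxy
      linarith
    exact Prod.ext (by exact_mod_cast h3) hxy

/-- The coefficient of `z ^ d` in the product of the two oscillator exponentials, on a sector
(a finite sum on every vector). -/
def osc (p : K) (V : NExp n K) (d : ℚ) : Module.End K (Sector n K) where
  toFun f := ∑ᶠ x : ℕ × ℕ, V.oscTerm p d x f
  map_add' f g := by
    simp only [map_add]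
    exact finsum_add_distrib (V.oscTerm_finite p d f) (V.oscTerm_finite p d g)
  map_smul' c f := by
    simp only [map_smul, RingHom.id_apply]
    exact (smul_finsum' c (V.oscTerm_finite p d f)).symm

/-- The operator series of a normally ordered exponential. -/
def series (p : K) (V : NExp n K) : Series n K := fun r =>
  Finsupp.lsum K fun w : Charge n =>
    (Finsupp.lsingle (w.1, w.2.1 + V.shA, w.2.2 + V.shB) : Sector n K →ₗ[K] Fock n K) ∘ₗ
      (V.scal w • V.osc p (r - V.pow w))

end NExp

/-- The `q`-difference operator `∂ f(z) = (f(q^{1/2} z) - f(q^{-1/2} z)) / ((q^{1/2} - q^{-1/2}) z)`: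
if `G y` is the series `f(q ^ y z)`, then `qdiff p G y` is the series `(∂ f)(q ^ y z)`. -/
def qdiff {n : ℕ} {K : Type*} [Field K] (p : K) (G : ℚ → Series n K) : ℚ → Series n K :=
  fun y r => ((qpow p (1 / 2) - qpow p (-1 / 2)) * qpow p y)⁻¹ •
    (G (y + 1 / 2) (r + 1) - G (y - 1 / 2) (r + 1))

/-! ### The currents and the vertex operator -/

section Currents

variable {K : Type*} [Field K]

/-- `Y_i^±(z)`, with the sign `s = ±1`. -/
def Y (p : K) (n i : ℕ) (s : ℤ) : NExp n K where
  creA k j := if (j : ℕ) + 1 = i then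
    s * (qpow p ((s : ℚ) * (k : ℕ) / 4) / qnum p (-((k : ℕ) : ℚ) / 2)) else 0
  creB _ _ := 0
  annA k j := if (j : ℕ) + 1 = i then
    -s * (qpow p ((s : ℚ) * (k : ℕ) / 4) / qnum p (-((k : ℕ) : ℚ) / 2)) else 0
  annB _ _ := 0
  shA := s • root n i
  shB := 0
  scal _ := 1
  pow w := -s * (2 * form (toRat (root n i)) w.al)

/-- `Z_i^±(q ^ y z)`, with the sign `s = ±1`. -/
def Z (p : K) (n i : ℕ) (s : ℤ) (y : ℚ) : NExp n K where
  creA _ _ := 0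
  creB k j := if (j : ℕ) + 1 = i then s * (qpow p (y * (k : ℕ)) / ((k : ℕ) : K)) else 0
  annA _ _ := 0
  annB k j := if (j : ℕ) + 1 = i then -s * (qpow p (-(y * (k : ℕ))) / ((k : ℕ) : K)) else 0
  shA := 0
  shB := s • eps n i
  scal w := qpow p (y * (s * (2 * form (toRat (eps n i)) w.be)))
  pow w := s * (2 * form (toRat (eps n i)) w.be)

/-- `X_i^+(z)`: it is `∂Z_i^+(z) Z_{i+1}^-(z) Y_i^+(z)` for `i < n`, and
`((q^{1/2} + q^{-1/2})⁻¹ :Z_n^+(z) ∂²Z_n^+(z): - :∂Z_n^+(q^{1/2} z) ∂Z_n^+(q^{-1/2} z):) Y_n^+(z)`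
for `i = n`. -/
def Xplus (p : K) (n i : ℕ) : Series n K :=
  if i < n then
    qdiff p (fun y => (Z p n i 1 y * Z p n (i + 1) (-1) 0 * Y p n i 1).series p) 0
  else
    (qpow p (1 / 2) + qpow p (-1 / 2))⁻¹ •
        qdiff p (qdiff p fun y => (Z p n n 1 0 * Z p n n 1 y * Y p n n 1).series p) 0
      - qdiff p (fun x => qdiff p
          (fun y => (Z p n n 1 x * Z p n n 1 y * Y p n n 1).series p) (-1 / 2)) (1 / 2)

/-- `X_i^-(z)`: it is `Z_i^-(z) ∂Z_{i+1}^+(z) Y_i^-(z)` for `i < n`, and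
`(q^{1/2} + q^{-1/2})⁻¹ :Z_n^-(q^{1/2} z) Z_n^-(q^{-1/2} z): Y_n^-(z)` for `i = n`. -/
def Xminus (p : K) (n i : ℕ) : Series n K :=
  if i < n then
    qdiff p (fun y => (Z p n i (-1) 0 * Z p n (i + 1) 1 y * Y p n i (-1)).series p) 0
  else
    (qpow p (1 / 2) + qpow p (-1 / 2))⁻¹ •
      (Z p n n (-1) (1 / 2) * Z p n n (-1) (-1 / 2) * Y p n n (-1)).series p

/-- The mode `x(m)` of a current `X(z) = ∑_m x(m) z ^ (-m-1)`. -/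
def mode {n : ℕ} (X : Series n K) (m : ℤ) : Module.End K (Fock n K) := X (-(m : ℚ) - 1)

/-- The coefficient of `a_{j+1}(m)` in the element `a_{\bar 1}(m)` of the Heisenberg algebra,
which satisfies `[a_i(m), a_{\bar 1}(l)] = δ_{i1} δ_{m,-l}` (for `n ≥ 2`). -/
def abarCoeff (p : K) (n : ℕ) (m : ℤ) (j : Fin n) : K :=
  (m : K) / qnum p ((m : ℚ) / 2) ^ 2 *
    (if (j : ℕ) + 1 < n then qnum p (((n : ℚ) - (j : ℕ)) * m) / qnum p (((n : ℚ) - (j : ℕ)) * m / 2) else 1) *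
    (qnum p (((n : ℚ) + 1) * m / 2) / qnum p (((n : ℚ) + 1) * m))

/-- The factor of `Φ_{\bar 1}(z)` that involves the Heisenberg algebra of the `a_i`:
`exp (∑_{k ≥ 1} ([k/2]/k) q^{(n+1/4)k} a_{\bar 1}(-k) z^k)`
`exp (∑_{k ≥ 1} ([k/2]/k) q^{-(n+3/4)k} a_{\bar 1}(k) z^{-k})`
`e^{λ_1} (q^{n+1/2} z)^{-λ_1(0) + 1 - λ_1(μ)}`, where `λ_1(0)` acts on `|α, β⟩` as
`λ_1(α) = 2 (λ_1 | α)`, and `λ_1(μ) = 2 (λ_1 | μ)`. -/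
def phiA (p : K) (n : ℕ) (μ : Fin n → ℚ) : NExp n K where
  creA k j := qnum p (((k : ℕ) : ℚ) / 2) / ((k : ℕ) : K) * qpow p (((n : ℚ) + 1 / 4) * (k : ℕ)) *
    abarCoeff p n (-(k : ℕ)) j
  creB _ _ := 0
  annA k j := qnum p (((k : ℕ) : ℚ) / 2) / ((k : ℕ) : K) * qpow p (-(((n : ℚ) + 3 / 4) * (k : ℕ))) *
    abarCoeff p n (k : ℕ) j
  annB _ _ := 0
  shA := fundWt n 1
  shB := 0
  scal w := qpow p (((n : ℚ) + 1 / 2) *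
    (-(2 * form (toRat (fundWt n 1)) w.al) + 1 - 2 * form (toRat (fundWt n 1)) μ))
  pow w := -(2 * form (toRat (fundWt n 1)) w.al) + 1 - 2 * form (toRat (fundWt n 1)) μ

/-- The component `Φ_{\bar 1}(z)` of the type I vertex operator on the module of highest weight
`μ_{ι+1}`, as an operator on the whole Fock space; `c` is its normalization constant. -/
def PhiBar1 (p : K) (n : ℕ) (ι : Fin 4) (c : K) : Series n K :=
  c • qdiff p (fun y => (phiA p n (mu n ι) * Z p n 1 1 ((n : ℚ) + 1 / 2 + y)).series p) 0

/-- The `v`-commutator `[A(z), B(w)]_v = A(z) B(w) - v B(w) A(z)`; the value at `(r, s)` is the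
coefficient of `z ^ r w ^ s`. -/
def qcomm {n : ℕ} (v : K) (A B : Series n K) : ℚ → ℚ → Module.End K (Fock n K) :=
  fun r s => A r * B s - v • (B s * A r)

/-- Multiplication of a series in `z`, `w` by `z / w`. -/
def mulZdivW {n : ℕ} (G : ℚ → ℚ → Module.End K (Fock n K)) :
    ℚ → ℚ → Module.End K (Fock n K) :=
  fun r s => G (r - 1) (s + 1)

end Currents

end

end SpVertex

/-!
Each factor of the vertex operator and of the currents is a normally ordered exponential, and by
Wick's theorem `V(z) W(w)` is a scalar series in `t = w / z` times `:V(z) W(w):`, while `W(w) V(z)`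
is a scalar series in `t⁻¹` times the same operator. So only the scalar series have to be compared.

The modes of `a_{\bar 1}` pair to zero with the modes of every `a_i`, `i ≥ 2`: with
`H(N) = q^{N x} + q^{-N x}`, the recurrence `H(1) H(N) = H(N + 1) + H(N - 1)` cancels the
contributions of neighbouring simple roots. Hence `Φ_{\bar 1}(z)` has trivial scalar series with
`X_i^±(w)` for `i ≥ 2`. For `i = 1` the contractions are differences of logarithms, so that the
scalar series are expansions of functions `(1 - a t) / (1 - b t)`.

Undoing the `q`-differences, `Φ_{\bar 1}` and `X_1^±` become combinations of two exponentials each,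
with shifts `y` and `x` in `{1/2, -1/2}`. In `[Φ_{\bar 1}(z), X_1^+(w)]` the two expansions belong
to the same rational function, and their difference is `q^y - q^x` times a delta function supported
on `w = q^{n + 1/2} z`. There the normally ordered products for `(y, x)` and `(x, y)` agree, so the
four terms cancel. In `[Φ_{\bar 1}(z), X_1^-(w)]_v`, for each `y` one of the two scalar series is
constant and the other is geometric, and the relation between `v = q^{-1/2}` and `v = q^{1/2}` is
the recurrence of a geometric series.
-/

namespace SpVertex

noncomputable section

section ExpSeries

open PowerSeries Finset

variable {K R : Type*} [Field K] [Ring R] [Algebra K R]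

/-- The power series `∑_{k ≥ 1} A k t ^ k`, in the form in which `expCoeff` uses it. -/
def modeSeries (A : ℕ+ → R) : R⟦X⟧ :=
  mk fun m => if h : 0 < m then A (m.toPNat h) else 0

/-- The power series `exp (∑_{k ≥ 1} A k t ^ k)`. -/
def expSeries (K : Type*) {R : Type*} [Field K] [Ring R] [Algebra K R] (A : ℕ+ → R) : R⟦X⟧ :=
  mk (expCoeff (K := K) A)

@[simp]
theorem coeff_expSeries (A : ℕ+ → R) (N : ℕ) :
    coeff N (expSeries K A) = expCoeff (K := K) A N :=
  coeff_mk _ _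

@[simp]
theorem coeff_zero_modeSeries (A : ℕ+ → R) : coeff 0 (modeSeries A) = 0 := by
  simp [modeSeries]

@[simp]
theorem coeff_toPNat_modeSeries (A : ℕ+ → R) (k : ℕ+) : coeff (k : ℕ) (modeSeries A) = A k := by
  simp only [modeSeries, coeff_mk, k.pos, dif_pos]
  rfl

theorem coeff_modeSeries_induction {P : ℕ → R → Prop} (A : ℕ+ → R) (h0 : P 0 0)
    (hA : ∀ k : ℕ+, P k (A k)) (m : ℕ) : P m (coeff m (modeSeries A)) := by
  rcases Nat.eq_zero_or_pos m with rfl | hm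
  · simpa using h0
  · lift m to ℕ+ using hm
    simpa using hA m

theorem modeSeries_add (A B : ℕ+ → R) : modeSeries (A + B) = modeSeries A + modeSeries B := by
  ext m
  simp only [modeSeries, coeff_mk, map_add, Pi.add_apply]
  split_ifs <;> simp

theorem coeff_modeSeries_pow_of_lt (A : ℕ+ → R) {j N : ℕ} (h : N < j) :
    coeff N (modeSeries A ^ j) = 0 :=
  coeff_of_lt_order N <| (Nat.cast_lt.mpr h).trans_le <|
    le_order_pow_of_constantCoeff_eq_zero j <| by simp [← coeff_zero_eq_constantCoeff_apply]

theorem expCoeff_eq_sum (A : ℕ+ → R) {N B : ℕ} (h : N < B) :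
    expCoeff (K := K) A N = ∑ j ∈ range B, (j.factorial : K)⁻¹ • coeff N (modeSeries A ^ j) :=
  sum_subset (by simpa using h) fun j _ hj =>
    (congrArg _ (coeff_modeSeries_pow_of_lt A (by simpa using hj))).trans (smul_zero _)

@[simp]
theorem expCoeff_zero (A : ℕ+ → R) : expCoeff (K := K) A 0 = 1 := by
  simp [expCoeff_eq_sum A zero_lt_one]

theorem commute_of_coeff {f g : R⟦X⟧} (h : ∀ m l, Commute (coeff m f) (coeff l g)) :
    Commute f g := by
  ext N
  rw [coeff_mul, coeff_mul, ← Nat.sum_antidiagonal_swap]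
  exact sum_congr rfl fun x _ => (h _ _).eq

theorem commute_coeff_modeSeries_right {A : ℕ+ → R} {y : R} (h : ∀ k, Commute y (A k)) (m : ℕ) :
    Commute y (coeff m (modeSeries A)) :=
  coeff_modeSeries_induction (P := fun _ => Commute y) A (.zero_right y) h m

theorem commute_coeff_modeSeries {A B : ℕ+ → R} (h : ∀ k l, Commute (A k) (B l)) (m l : ℕ) :
    Commute (coeff m (modeSeries A)) (coeff l (modeSeries B)) :=
  commute_coeff_modeSeries_right
    (fun k => (commute_coeff_modeSeries_right (fun i => (h i k).symm) m).symm) l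

/-! #### Derivations of exponentials -/

theorem map_pow_succ_of_leibniz {A : Type*} [Ring A] (D : A → A)
    (hD : ∀ f g, D (f * g) = D f * g + f * D g) {f : A} (hf : Commute (D f) f) (j : ℕ) :
    D (f ^ (j + 1)) = (j + 1) • (D f * f ^ j) := by
  induction j with
  | zero => simp
  | succ j ih =>
    rw [pow_succ, hD, ih, ← (hf.pow_right (j + 1)).eq, succ_nsmul _ (j + 1), smul_mul_assoc,
      mul_assoc, ← pow_succ]

theorem map_expSeries_of_leibniz [CharZero K] (D : R⟦X⟧ →ₗ[K] R⟦X⟧)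
    (hD : ∀ f g, D (f * g) = D f * g + f * D g) (hord : ∀ f, f.order ≤ (D f).order) {A : ℕ+ → R}
    (hA : Commute (D (modeSeries A)) (modeSeries A)) :
    D (expSeries K A) = D (modeSeries A) * expSeries K A := by
  set b := modeSeries A
  set T : ℕ → R⟦X⟧ := fun B => ∑ j ∈ range B, (j.factorial : K)⁻¹ • b ^ j with hT
  have htrunc (N B : ℕ) (h : N < B) : coeff N (T B) = coeff N (expSeries K A) := by
    simp [hT, expCoeff_eq_sum A h, b]
  have hDT (B : ℕ) : D (T (B + 1)) = D b * T B := by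
    have hD1 : D 1 = 0 := by simpa using hD 1 1
    simp only [hT, map_sum, map_add, map_smul, sum_range_succ', mul_sum, pow_zero, hD1, smul_zero,
      add_zero]
    refine sum_congr rfl fun j _ => ?_
    rw [map_pow_succ_of_leibniz D hD hA, ← Nat.cast_smul_eq_nsmul K, smul_smul, mul_smul_comm]
    congr 1
    rw [Nat.factorial_succ, Nat.cast_mul, mul_inv_rev,
      inv_mul_cancel_right₀ (Nat.cast_ne_zero.mpr j.succ_ne_zero)]
  have hloc (N : ℕ) : coeff N (D (expSeries K A)) = coeff N (D (T (N + 2))) := by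
    rw [← sub_eq_zero, ← map_sub, ← map_sub]
    refine coeff_of_lt_order N (lt_of_lt_of_le (Nat.cast_lt.mpr N.lt_succ_self) ?_)
    refine (nat_le_order _ _ fun i hi => ?_).trans (hord _)
    rw [map_sub, htrunc i _ (by omega), sub_self]
  ext N
  rw [hloc, hDT, coeff_mul, coeff_mul]
  refine sum_congr rfl fun x hx => ?_
  rw [htrunc _ _ (Nat.lt_succ_of_le (HasAntidiagonal.antidiagonal.snd_le hx))]

/-- The Euler operator `t d/dt`. -/
def euler (K : Type*) {R : Type*} [Field K] [Ring R] [Algebra K R] : R⟦X⟧ →ₗ[K] R⟦X⟧ where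
  toFun f := mk fun N => N • coeff N f
  map_add' f g := by ext; simp
  map_smul' c f := by ext; simp [smul_comm]

@[simp]
theorem coeff_euler (f : R⟦X⟧) (N : ℕ) : coeff N (euler K f) = N • coeff N f := by
  simp [euler]

theorem euler_mul (f g : R⟦X⟧) : euler K (f * g) = euler K f * g + f * euler K g := by
  ext N
  simp only [coeff_euler, map_add, coeff_mul, smul_sum, ← sum_add_distrib]
  refine sum_congr rfl fun x hx => ?_
  rw [← mem_antidiagonal.mp hx, add_smul, smul_mul_assoc, mul_smul_comm]

theorem euler_expSeries [CharZero K] {A : ℕ+ → R} (hA : ∀ k l, Commute (A k) (A l)) :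
    euler K (expSeries K A) = euler K (modeSeries A) * expSeries K A := by
  refine map_expSeries_of_leibniz (euler K) euler_mul (fun f => le_order _ _ fun i hi => ?_) ?_
  · rw [coeff_euler, coeff_of_lt_order i hi, smul_zero]
  · refine commute_of_coeff fun m l => ?_
    rw [coeff_euler]
    refine Commute.smul_left ?_ m
    exact commute_coeff_modeSeries hA m l

theorem eq_zero_of_euler_eq_mul [CharZero K] {b f : R⟦X⟧} (hb : coeff 0 b = 0)
    (hf : coeff 0 f = 0) (h : euler K f = b * f) : f = 0 := by
  ext N
  induction N using Nat.strong_induction_on with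
  | _ N ih =>
    rcases Nat.eq_zero_or_pos N with rfl | hN
    · simpa using hf
    have hmul : N • coeff N f = 0 := by
      rw [← coeff_euler (K := K), h, coeff_mul]
      refine sum_eq_zero fun x hx => ?_
      have hx' := mem_antidiagonal.mp hx
      rcases Nat.eq_zero_or_pos x.1 with h0 | h0
      · rw [h0, hb, zero_mul]
      · rw [ih _ (by omega), map_zero, mul_zero]
    rw [← Nat.cast_smul_eq_nsmul K] at hmul
    simpa [hN.ne'] using hmul

theorem eq_of_euler_eq_mul [CharZero K] {b f g : R⟦X⟧} (hb : coeff 0 b = 0)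
    (hfg : coeff 0 f = coeff 0 g) (hf : euler K f = b * f) (hg : euler K g = b * g) : f = g :=
  sub_eq_zero.mp <| eq_zero_of_euler_eq_mul (K := K) hb (by rw [map_sub, hfg, sub_self])
    (by rw [map_sub, hf, hg, mul_sub])

theorem commute_C_algebraMap_mul_X_pow (c : K) (k : ℕ) (f : R⟦X⟧) :
    Commute (C (algebraMap K R c) * X ^ k) f := by
  refine .mul_left ?_ ((commute_X f).symm.pow_left k)
  rw [← PowerSeries.algebraMap_apply]
  exact Algebra.commute_algebraMap_left c f

/-- If the commutators `[a, B_l]` are scalars, `a` acts on functions of the `B_l` by a derivation,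
so that conjugation by `exp (∑ B_l t ^ l)` only adds a scalar series to `a`. -/
theorem C_mul_expSeries [CharZero K] {B : ℕ+ → R} {a : R} {k : ℕ+} {c : K}
    (h : ∀ l, a * B l = B l * a + if l = k then algebraMap K R c else 0) :
    C a * expSeries K B = expSeries K B * (C a + C (algebraMap K R c) * X ^ (k : ℕ)) := by
  set τ : R⟦X⟧ := C (algebraMap K R c) * X ^ (k : ℕ) with hτ
  let D : R⟦X⟧ →ₗ[K] R⟦X⟧ := LinearMap.mulLeft K (C a) - LinearMap.mulRight K (C a)
  have hDapply (f : R⟦X⟧) : D f = C a * f - f * C a := rfl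
  have hDmode : D (modeSeries B) = τ := by
    ext m
    rw [hDapply, hτ, map_sub, coeff_C_mul, coeff_mul_C, coeff_C_mul, coeff_X_pow,
      sub_eq_iff_eq_add']
    refine coeff_modeSeries_induction (P := fun m x => a * x = x * a + _ * if m = k then 1 else 0)
      B ?_ (fun l => ?_) m
    · simp [k.ne_zero.symm]
    · simp [h, PNat.coe_inj]
  have hD : D (expSeries K B) = τ * expSeries K B := by
    rw [← hDmode]
    refine map_expSeries_of_leibniz D (fun f g => ?_) (fun f => le_order _ _ fun i hi => ?_) ?_
    · simp only [hDapply]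
      noncomm_ring
    · rw [hDapply, map_sub, coeff_C_mul, coeff_mul_C, coeff_of_lt_order i hi]
      simp
    · rw [hDmode]
      exact commute_C_algebraMap_mul_X_pow c k _
  rw [mul_add, ← (commute_C_algebraMap_mul_X_pow c k _).eq, ← sub_eq_iff_eq_add']
  exact hD

/-! #### Functoriality -/

theorem expCoeff_induction₂ {R' : Type*} [Ring R'] [Algebra K R'] {r : ℕ → R → R' → Prop}
    (zero : ∀ N, r N 0 0) (one : r 0 1 1)
    (add : ∀ {N a a' b b'}, r N a b → r N a' b' → r N (a + a') (b + b'))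
    (smul : ∀ {N a b} (c : K), r N a b → r N (c • a) (c • b))
    (mul : ∀ {M N a a' b b'}, r M a b → r N a' b' → r (M + N) (a * a') (b * b'))
    {A : ℕ+ → R} {B : ℕ+ → R'} (h : ∀ k : ℕ+, r k (A k) (B k)) (N : ℕ) :
    r N (expCoeff (K := K) A N) (expCoeff (K := K) B N) := by
  have sum {ι : Type} (s : Finset ι) (N : ℕ) (f : ι → R) (g : ι → R')
      (hfg : ∀ i ∈ s, r N (f i) (g i)) : r N (∑ i ∈ s, f i) (∑ i ∈ s, g i) := by
    induction s using Finset.cons_induction with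
    | empty => exact zero N
    | cons i s hi ih =>
      rw [sum_cons, sum_cons]
      exact add (hfg i (mem_cons_self i s)) (ih fun j hj => hfg j (mem_cons_of_mem hj))
  have pow (j N : ℕ) : r N (coeff N (modeSeries A ^ j)) (coeff N (modeSeries B ^ j)) := by
    induction j generalizing N with
    | zero =>
      simp only [pow_zero, coeff_one]
      split_ifs with hN
      exacts [hN ▸ one, zero N]
    | succ j ih =>
      simp only [pow_succ, coeff_mul]
      refine sum _ N _ _ fun x hx => ?_
      rw [← mem_antidiagonal.mp hx]
      refine mul (ih _) ?_
      simp only [modeSeries, coeff_mk]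
      split_ifs with hx2
      exacts [h (x.2.toPNat hx2), zero _]
  rw [expCoeff_eq_sum A N.lt_succ_self, expCoeff_eq_sum B N.lt_succ_self]
  exact sum _ N _ _ fun j _ => smul _ (pow j N)

theorem semiconjBy_expCoeff {A B : ℕ+ → R} {y : R} (h : ∀ k, SemiconjBy y (A k) (B k)) (N : ℕ) :
    SemiconjBy y (expCoeff (K := K) A N) (expCoeff (K := K) B N) :=
  expCoeff_induction₂ (r := fun _ => SemiconjBy y) (fun _ => .zero_right y) (.one_right y)
    .add_right (fun c h => by simp [SemiconjBy, h.eq]) .mul_right h N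

theorem expCoeff_commute {A B : ℕ+ → R} (h : ∀ k l, Commute (A k) (B l)) (M N : ℕ) :
    Commute (expCoeff (K := K) A M) (expCoeff (K := K) B N) :=
  semiconjBy_expCoeff
    (fun l => (semiconjBy_expCoeff (fun k => (h k l).symm) M : Commute _ _).symm) N

theorem map_expCoeff {R' : Type*} [Ring R'] [Algebra K R'] (φ : R →ₐ[K] R') (A : ℕ+ → R) (N : ℕ) :
    φ (expCoeff (K := K) A N) = expCoeff (K := K) (φ ∘ A) N :=
  expCoeff_induction₂ (r := fun _ a b => φ a = b) (fun _ => map_zero φ) (map_one φ)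
    (fun h h' => by rw [map_add, h, h']) (fun c h => by rw [map_smul, h])
    (fun h h' => by rw [map_mul, h, h']) (fun _ => rfl) N

theorem expCoeff_mul_pow {A : ℕ+ → R} {u : R} (hu : ∀ k, Commute u (A k)) (N : ℕ) :
    expCoeff (K := K) (fun k => A k * u ^ (k : ℕ)) N = expCoeff (K := K) A N * u ^ N :=
  And.left <| expCoeff_induction₂ (r := fun N a b => a = b * u ^ N ∧ Commute u b)
    (fun _ => ⟨(zero_mul _).symm, .zero_right u⟩) ⟨by simp, .one_right u⟩
    (fun h h' => ⟨by rw [h.1, h'.1, add_mul], h.2.add_right h'.2⟩)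
    (fun c h => ⟨by rw [h.1, smul_mul_assoc], h.2.smul_right c⟩)
    (fun {M N _ _ b b'} h h' => ⟨by
      rw [h.1, h'.1, pow_add, mul_assoc, mul_assoc, ← mul_assoc (u ^ M), (h'.2.pow_left M).eq,
        mul_assoc], h.2.mul_right h'.2⟩)
    (fun k => ⟨rfl, hu k⟩) N

theorem expSeries_add [CharZero K] {A B : ℕ+ → R} (hA : ∀ k l, Commute (A k) (A l))
    (hB : ∀ k l, Commute (B k) (B l)) (hAB : ∀ k l, Commute (A k) (B l)) :
    expSeries K (A + B) = expSeries K A * expSeries K B := by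
  refine eq_of_euler_eq_mul (K := K) (b := euler K (modeSeries (A + B))) (by simp)
    (by simp [coeff_mul]) (euler_expSeries fun k l => ?_) ?_
  · exact ((hA k l).add_right (hAB k l)).add_left ((hAB l k).symm.add_right (hB k l))
  · have hcomm : Commute (expSeries K A) (euler K (modeSeries B)) := by
      refine commute_of_coeff fun m l => ?_
      rw [coeff_euler, coeff_expSeries]
      refine Commute.smul_right (commute_coeff_modeSeries_right (fun k => ?_) l) l
      exact (semiconjBy_expCoeff (fun i => (hAB i k).symm) m : Commute _ _).symm
    rw [euler_mul, euler_expSeries hA, euler_expSeries hB, modeSeries_add, map_add, add_mul,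
      ← mul_assoc (expSeries K A), hcomm.eq, mul_assoc, mul_assoc]

theorem expCoeff_add [CharZero K] {A B : ℕ+ → R} (hA : ∀ k l, Commute (A k) (A l))
    (hB : ∀ k l, Commute (B k) (B l)) (hAB : ∀ k l, Commute (A k) (B l)) (N : ℕ) :
    expCoeff (K := K) (A + B) N =
      ∑ x ∈ antidiagonal N, expCoeff (K := K) A x.1 * expCoeff (K := K) B x.2 := by
  simpa only [coeff_mul, coeff_expSeries] using congrArg (coeff N) (expSeries_add hA hB hAB)

/-- With `A(s) = ∑ A_k s ^ k` and `B(t) = ∑ B_l t ^ l`, this is the coefficient of `s ^ j t ^ N` in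
`exp A(s) exp B(t) = exp (∑ c_k (s t) ^ k) exp B(t) exp A(s)`, which follows by conjugating the
modes `A_k` inside the first exponential with the second one. -/
theorem expCoeff_mul_expCoeff [CharZero K] {A B : ℕ+ → R} {c : ℕ+ → K}
    (hA : ∀ k l, Commute (A k) (A l))
    (h : ∀ k l, A k * B l = B l * A k + if l = k then algebraMap K R (c k) else 0) (j N : ℕ) :
    expCoeff (K := K) A j * expCoeff (K := K) B N =
      ∑ x ∈ antidiagonal j, if x.2 ≤ N then
        expCoeff (K := K) c x.2 • (expCoeff (K := K) B (N - x.2) * expCoeff (K := K) A x.1)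
        else 0 := by
  let constants : R →ₐ[K] R⟦X⟧ := { C with commutes' := fun _ => PowerSeries.algebraMap_apply.symm }
  let a : ℕ+ → R⟦X⟧ := constants ∘ A
  let τ : ℕ+ → R⟦X⟧ := fun k => C (algebraMap K R (c k)) * X ^ (k : ℕ)
  have hτ (k : ℕ+) (f : R⟦X⟧) : Commute (τ k) f := commute_C_algebraMap_mul_X_pow (c k) k f
  have hconj : C (expCoeff (K := K) A j) * expSeries K B = expSeries K B *
      ∑ x ∈ antidiagonal j, expCoeff (K := K) a x.1 * expCoeff (K := K) τ x.2 := by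
    rw [← expCoeff_add (A := a) (fun k l => (hA k l).map constants) (fun k l => hτ k _)
      (fun k l => (hτ l _).symm)]
    refine Eq.trans ?_ (semiconjBy_expCoeff (K := K) (B := a) (fun k => ?_) j).eq.symm
    · rw [← map_expCoeff]
      rfl
    · exact (C_mul_expSeries (h k)).symm
  have hcre (i : ℕ) : expCoeff (K := K) a i = C (expCoeff (K := K) A i) :=
    (map_expCoeff constants A i).symm
  have hexp (i : ℕ) : expCoeff (K := K) τ i =
      C (algebraMap K R (expCoeff (K := K) c i)) * X ^ i := by
    rw [expCoeff_mul_pow fun k => (commute_X _).symm]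
    congr 1
    exact (map_expCoeff (constants.comp (Algebra.ofId K R)) c i).symm
  rw [← coeff_expSeries (A := B), ← coeff_C_mul, hconj, mul_sum, map_sum]
  refine sum_congr rfl fun x _ => ?_
  rw [hcre, hexp, ← mul_assoc, ← mul_assoc, coeff_mul_X_pow', coeff_mul_C, coeff_mul_C,
    coeff_expSeries]
  split_ifs
  · rw [Algebra.smul_def, Algebra.commutes]
  · rfl

/-! #### Coefficients indexed by integers -/

/-- The coefficient of `t ^ j`, `j ∈ ℤ`, in `exp (∑_{k ≥ 1} A k t ^ k)`; it vanishes for `j < 0`. -/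
def expZ (K : Type*) {R : Type*} [Field K] [Ring R] [Algebra K R] (A : ℕ+ → R) (j : ℤ) : R :=
  if 0 ≤ j then expCoeff (K := K) A j.toNat else 0

@[simp]
theorem expZ_natCast (A : ℕ+ → R) (j : ℕ) : expZ K A j = expCoeff (K := K) A j := by
  simp [expZ]

theorem expZ_of_neg (A : ℕ+ → R) {j : ℤ} (h : j < 0) : expZ K A j = 0 :=
  if_neg (not_le.mpr h)

theorem expZ_commute {A B : ℕ+ → R} (h : ∀ k l, Commute (A k) (B l)) (M N : ℤ) :
    Commute (expZ K A M) (expZ K B N) := by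
  unfold expZ
  split_ifs
  exacts [expCoeff_commute h _ _, .zero_right _, .zero_left _, .zero_left _]

theorem expZ_smul_pow (A : ℕ+ → R) (u : K) (N : ℤ) :
    expZ K (fun k => u ^ (k : ℕ) • A k) N = u ^ N • expZ K A N := by
  rcases lt_or_ge N 0 with hN | hN
  · rw [expZ_of_neg _ hN, expZ_of_neg _ hN, smul_zero]
  lift N to ℕ using hN
  have hpow := expCoeff_mul_pow (K := K) (A := A) (u := algebraMap K R u)
    (fun k => Algebra.commutes u _) N
  simpa only [← map_pow, ← Algebra.commutes (u ^ _), ← Algebra.smul_def, expZ_natCast,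
    zpow_natCast] using hpow

theorem finsum_int_eq_sum_antidiagonal {M : Type*} [AddCommMonoid M] (g : ℤ → M) (j : ℕ)
    (hg : ∀ m : ℤ, m < 0 ∨ (j : ℤ) < m → g m = 0) :
    ∑ᶠ m, g m = ∑ x ∈ antidiagonal j, g x.2 := by
  rw [finsum_eq_sum_of_support_subset (s := (range (j + 1)).map Nat.castEmbedding), sum_map,
    ← Nat.sum_antidiagonal_swap, Nat.sum_antidiagonal_eq_sum_range_succ_mk]
  · rfl
  · intro m hm
    obtain ⟨h0, hj⟩ := not_or.mp fun h => hm (hg m h)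
    simp only [coe_map, coe_range, Set.mem_image, Set.mem_Iio]
    exact ⟨m.toNat, by omega, by simp; omega⟩

theorem expZ_add [CharZero K] {A B : ℕ+ → R} (hA : ∀ k l, Commute (A k) (A l))
    (hB : ∀ k l, Commute (B k) (B l)) (hAB : ∀ k l, Commute (A k) (B l)) (N : ℤ) :
    expZ K (A + B) N = ∑ᶠ l : ℤ, expZ K A (N - l) * expZ K B l := by
  have hzero (m : ℤ) (hm : m < 0 ∨ N < m) : expZ K A (N - m) * expZ K B m = 0 := by
    rcases hm with h | h
    · rw [expZ_of_neg B h, mul_zero]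
    · rw [expZ_of_neg A (by omega), zero_mul]
  rcases lt_or_ge N 0 with hN | hN
  · rw [expZ_of_neg _ hN, finsum_eq_zero_of_forall_eq_zero fun m => hzero m (by omega)]
  lift N to ℕ using hN
  rw [expZ_natCast, expCoeff_add hA hB hAB, finsum_int_eq_sum_antidiagonal _ N hzero]
  refine sum_congr rfl fun x hx => ?_
  have hx' := mem_antidiagonal.mp hx
  rw [show (N : ℤ) - x.2 = (x.1 : ℤ) by omega, expZ_natCast, expZ_natCast]

theorem expZ_mul_expZ [CharZero K] {A B : ℕ+ → R} {c : ℕ+ → K}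
    (hA : ∀ k l, Commute (A k) (A l))
    (h : ∀ k l, A k * B l = B l * A k + if l = k then algebraMap K R (c k) else 0) (j N : ℤ) :
    expZ K A j * expZ K B N =
      ∑ᶠ m : ℤ, expZ K c m • (expZ K B (N - m) * expZ K A (j - m)) := by
  have hzero (m : ℤ) (hm : m < 0 ∨ N < m ∨ j < m) :
      expZ K c m • (expZ K B (N - m) * expZ K A (j - m)) = 0 := by
    rcases hm with h | h | h
    · rw [expZ_of_neg _ h, zero_smul]
    · rw [expZ_of_neg B (by omega), zero_mul, smul_zero]
    · rw [expZ_of_neg A (by omega), mul_zero, smul_zero]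
  rcases lt_or_ge j 0 with hj | hj
  · rw [expZ_of_neg _ hj, zero_mul,
      finsum_eq_zero_of_forall_eq_zero fun m => hzero m (by omega)]
  rcases lt_or_ge N 0 with hN | hN
  · rw [expZ_of_neg _ hN, mul_zero,
      finsum_eq_zero_of_forall_eq_zero fun m => hzero m (by omega)]
  lift j to ℕ using hj
  lift N to ℕ using hN
  rw [expZ_natCast, expZ_natCast, expCoeff_mul_expCoeff hA h,
    finsum_int_eq_sum_antidiagonal _ j fun m hm => hzero m (by omega)]
  refine sum_congr rfl fun x hx => ?_
  have hx' := mem_antidiagonal.mp hx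
  split_ifs with hxN
  · rw [show (N : ℤ) - x.2 = ((N - x.2 : ℕ) : ℤ) by omega,
      show (j : ℤ) - x.2 = (x.1 : ℤ) by omega, expZ_natCast, expZ_natCast, expZ_natCast]
  · rw [hzero _ (by omega)]

/-! #### Exponentials of logarithms -/

/-- The coefficients of `-log (1 - b t) = ∑_{k ≥ 1} b ^ k t ^ k / k`. -/
def logCoeff (b : K) (k : ℕ+) : K := b ^ (k : ℕ) / (k : ℕ)

theorem euler_modeSeries_logCoeff [CharZero K] (b : K) :
    euler K (modeSeries (logCoeff b)) = (mk fun n => b ^ n) - 1 := by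
  ext n
  rw [coeff_euler, map_sub, coeff_mk, coeff_one]
  refine coeff_modeSeries_induction (P := fun n x => n • x = b ^ n - if n = 0 then 1 else 0)
    _ (by simp) (fun k => ?_) n
  simp [logCoeff, mul_div_cancel₀]

theorem expSeries_logCoeff [CharZero K] (b : K) :
    expSeries K (logCoeff b) = mk fun n => b ^ n := by
  refine eq_of_euler_eq_mul (K := K) (b := euler K (modeSeries (logCoeff b))) (by simp) (by simp)
    (euler_expSeries fun k l => .all _ _) ?_
  rw [euler_modeSeries_logCoeff, sub_mul, one_mul]
  ext n
  have hpow : ∀ x ∈ antidiagonal n, b ^ x.1 * b ^ x.2 = b ^ n := fun x hx => by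
    rw [← pow_add, mem_antidiagonal.mp hx]
  simp only [coeff_euler, map_sub, coeff_mk, coeff_mul, sum_congr rfl hpow, sum_const,
    Nat.card_antidiagonal, succ_nsmul, add_sub_cancel_right]

theorem mk_pow_mul_one_sub (b : K) : (mk fun n => b ^ n) * (1 - C b * X) = 1 := by
  ext n
  rw [mul_sub, mul_one, mul_left_comm, map_sub, coeff_C_mul]
  cases n <;> simp [coeff_succ_mul_X, pow_succ', coeff_one]

theorem expSeries_logCoeff_sub [CharZero K] (a b : K) :
    expSeries K (logCoeff b - logCoeff a) = (mk fun n => b ^ n) * (1 - C a * X) := by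
  have hadd := expSeries_add (K := K) (A := logCoeff b - logCoeff a) (B := logCoeff a)
    (fun _ _ => .all _ _) (fun _ _ => .all _ _) fun _ _ => .all _ _
  rw [sub_add_cancel, expSeries_logCoeff, expSeries_logCoeff] at hadd
  rw [hadd, mul_assoc, mk_pow_mul_one_sub, mul_one]

theorem expZ_logCoeff_sub [CharZero K] (a b : K) (j : ℤ) :
    expZ K (logCoeff b - logCoeff a) j =
      if j < 0 then 0 else if j = 0 then 1 else b ^ (j - 1) * (b - a) := by
  rcases lt_or_ge j 0 with hj | hj
  · rw [expZ_of_neg _ hj, if_pos hj]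
  lift j to ℕ using hj
  rw [if_neg (by omega), expZ_natCast, ← coeff_expSeries, expSeries_logCoeff_sub, mul_sub, mul_one,
    mul_left_comm, map_sub, coeff_C_mul]
  rcases j with _ | j
  · simp
  · rw [if_neg (by omega), coeff_succ_mul_X, coeff_mk, coeff_mk, Nat.cast_succ,
      add_sub_cancel_right, zpow_natCast]
    ring

theorem expZ_zero [CharZero K] (j : ℤ) :
    expZ K (0 : ℕ+ → K) j = if j = 0 then 1 else 0 := by
  rw [← sub_self (logCoeff 1), expZ_logCoeff_sub]
  split_ifs <;> first | rfl | omega | simp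

/-- Multiplication of `(1 - a t) / (1 - b t)` by `t⁻¹ - b`. -/
theorem expZ_logCoeff_sub_add_one [CharZero K] (a b : K) (j : ℤ) :
    expZ K (logCoeff b - logCoeff a) (j + 1) - b * expZ K (logCoeff b - logCoeff a) j =
      (if j = -1 then 1 else 0) - if j = 0 then a else 0 := by
  simp only [expZ_logCoeff_sub]
  obtain hj | rfl | rfl | ⟨i, rfl⟩ : j < -1 ∨ j = -1 ∨ j = 0 ∨ ∃ i : ℕ, j = i + 1 := by
    rcases lt_or_ge j 1 with hj | hj
    · omega
    · exact .inr (.inr (.inr ⟨(j - 1).toNat, by omega⟩))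
  · simp [show j < 0 by omega, show j + 1 < 0 by omega, show j ≠ -1 by omega, show j ≠ 0 by omega]
  · simp
  · simp
  · simp only [show ¬ (i : ℤ) + 1 + 1 < 0 by omega, show ¬ (i : ℤ) + 1 < 0 by omega,
      show (i : ℤ) + 1 + 1 ≠ 0 by omega, show (i : ℤ) + 1 ≠ 0 by omega,
      show (i : ℤ) + 1 ≠ -1 by omega, if_false, add_sub_cancel_right, sub_self]
    norm_cast
    ring

end ExpSeries

theorem finite_support_of_eq_zero {M : Type*} [Zero M] {g : ℤ → M} (a b : ℤ)
    (hg : ∀ m, m < a ∨ b < m → g m = 0) : (Function.support g).Finite :=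
  (Set.finite_Icc a b).subset fun m hm => by
    by_contra h
    exact hm (hg m (by rwa [Set.mem_Icc, not_and_or, not_le, not_le] at h))

namespace NExp

variable {n : ℕ} {K : Type*} [Field K]

@[simp] theorem creA_mul (V W : NExp n K) : (V * W).creA = V.creA + W.creA := rfl
@[simp] theorem creB_mul (V W : NExp n K) : (V * W).creB = V.creB + W.creB := rfl
@[simp] theorem annA_mul (V W : NExp n K) : (V * W).annA = V.annA + W.annA := rfl
@[simp] theorem annB_mul (V W : NExp n K) : (V * W).annB = V.annB + W.annB := rfl
@[simp] theorem shA_mul (V W : NExp n K) : (V * W).shA = V.shA + W.shA := rfl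
@[simp] theorem shB_mul (V W : NExp n K) : (V * W).shB = V.shB + W.shB := rfl
@[simp] theorem scal_mul (V W : NExp n K) : (V * W).scal = V.scal * W.scal := rfl
@[simp] protected theorem pow_mul (V W : NExp n K) : (V * W).pow = V.pow + W.pow := rfl

instance : CommSemigroup (NExp n K) where
  mul_assoc U V W := by ext1 <;> simp [add_assoc, mul_assoc]
  mul_comm V W := by ext1 <;> simp [add_comm, mul_comm]

/-- The commutator `[a_{i+1}(k), a_{j+1}(-k)]`. -/
def aPair (p : K) (n : ℕ) (k : ℕ+) (i j : Fin n) : K :=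
  qnum p ((k : ℕ) * form (toRat (root n ((i : ℕ) + 1))) (toRat (root n ((j : ℕ) + 1)))) *
    qnum p (-((k : ℕ) : ℚ) / 2) / ((k : ℕ) : K)

/-- The commutator of the annihilation mode of `V` with the creation mode of `W`. -/
def contr (p : K) (V W : NExp n K) (k : ℕ+) : K :=
  ∑ i, ∑ j, V.annA k i * W.creA k j * aPair p n k i j +
    ∑ i, V.annB k i * W.creB k i * ((k : ℕ) : K)

/-- The element of the polynomial ring by which the creation mode of `V` multiplies. -/
def creElt (V : NExp n K) (k : ℕ+) : Sector n K :=
  ∑ i, (V.creA k i • MvPolynomial.X (Sum.inl (i, k)) + V.creB k i • MvPolynomial.X (Sum.inr (i, k)))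

theorem creMode_eq_mulLeft (V : NExp n K) (k : ℕ+) :
    V.creMode k = LinearMap.mulLeft K (V.creElt k) := by
  refine LinearMap.ext fun f => ?_
  simp [creMode, creElt, aNeg, bNeg, LinearMap.sum_apply, Finset.sum_mul, add_mul]

/-- The annihilation mode of `V` as a derivation. -/
def annDer (p : K) (V : NExp n K) (k : ℕ+) : Derivation K (Sector n K) (Sector n K) :=
  ∑ i, (V.annA k i • ∑ j, aPair p n k i j • MvPolynomial.pderiv (Sum.inl (j, k)) +
    V.annB k i • ((k : ℕ) : K) • MvPolynomial.pderiv (Sum.inr (i, k)))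

theorem derivation_sum_apply {ι A : Type*} [CommRing A] [Algebra K A] (s : Finset ι)
    (D : ι → Derivation K A A) (f : A) : (∑ i ∈ s, D i) f = ∑ i ∈ s, D i f := by
  rw [← Derivation.coeFnAddMonoidHom_apply, map_sum, Finset.sum_apply]
  rfl

theorem annMode_apply (p : K) (V : NExp n K) (k : ℕ+) (f : Sector n K) :
    V.annMode p k f = V.annDer p k f := by
  simp [annMode, annDer, aPos, bPos, LinearMap.sum_apply, derivation_sum_apply, aPair]

theorem annDer_X_inl (p : K) (V : NExp n K) (k l : ℕ+) (j : Fin n) :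
    V.annDer p k (MvPolynomial.X (Sum.inl (j, l))) =
      if l = k then MvPolynomial.C (∑ i, V.annA k i * aPair p n k i j) else 0 := by
  simp only [annDer, derivation_sum_apply, Derivation.add_apply, Derivation.smul_apply,
    MvPolynomial.pderiv_X, Pi.single_apply, Sum.inl.injEq, Prod.mk.injEq, reduceCtorEq]
  by_cases h : l = k <;> simp [h, MvPolynomial.smul_eq_C_mul]

theorem annDer_X_inr (p : K) (V : NExp n K) (k l : ℕ+) (j : Fin n) :
    V.annDer p k (MvPolynomial.X (Sum.inr (j, l))) =
      if l = k then MvPolynomial.C (V.annB k j * ((k : ℕ) : K)) else 0 := by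
  simp only [annDer, derivation_sum_apply, Derivation.add_apply, Derivation.smul_apply,
    MvPolynomial.pderiv_X, Pi.single_apply, Sum.inr.injEq, Prod.mk.injEq, reduceCtorEq]
  by_cases h : l = k <;> simp [h, MvPolynomial.smul_eq_C_mul]

theorem annDer_creElt (p : K) (V W : NExp n K) (k l : ℕ+) :
    V.annDer p k (W.creElt l) = if l = k then MvPolynomial.C (contr p V W k) else 0 := by
  simp only [creElt, map_sum, map_add, Derivation.map_smul, annDer_X_inl, annDer_X_inr]
  split_ifs with h
  · subst h
    simp only [contr, MvPolynomial.smul_eq_C_mul, ← map_mul, ← map_add, ← map_sum]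
    rw [Finset.sum_add_distrib, Finset.sum_comm]
    simp only [Finset.mul_sum, mul_left_comm, mul_comm]
  · simp

theorem creMode_commute (V W : NExp n K) (k l : ℕ+) : Commute (V.creMode k) (W.creMode l) := by
  rw [creMode_eq_mulLeft, creMode_eq_mulLeft]
  exact LinearMap.ext fun f => mul_left_comm (V.creElt k) (W.creElt l) f

theorem annMode_commute (p : K) (V W : NExp n K) (k l : ℕ+) :
    Commute (V.annMode p k) (W.annMode p l) := by
  have hbracket : ⁅V.annDer p k, W.annDer p l⁆ = 0 := by
    refine MvPolynomial.derivation_ext fun v => ?_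
    rcases v with ⟨j, m⟩ | ⟨j, m⟩ <;>
    · simp only [Derivation.commutator_apply, annDer_X_inl, annDer_X_inr]
      split_ifs <;> simp
  refine LinearMap.ext fun f => ?_
  simp only [Module.End.mul_apply, annMode_apply]
  rw [← sub_eq_zero, ← Derivation.commutator_apply, hbracket, Derivation.zero_apply]

theorem annMode_mul_creMode (p : K) (V W : NExp n K) (k l : ℕ+) :
    V.annMode p k * W.creMode l = W.creMode l * V.annMode p k +
      if l = k then algebraMap K (Module.End K (Sector n K)) (contr p V W k) else 0 := by
  refine LinearMap.ext fun f => ?_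
  rw [creMode_eq_mulLeft]
  simp only [Module.End.mul_apply, annMode_apply, LinearMap.mulLeft_apply, Derivation.leibniz,
    annDer_creElt, smul_eq_mul, LinearMap.add_apply]
  split_ifs with h
  · simp [MvPolynomial.smul_eq_C_mul, mul_comm]
  · simp

theorem creMode_mul (V W : NExp n K) : (V * W).creMode = V.creMode + W.creMode := by
  funext k
  simp only [creMode, Pi.add_apply, ← Finset.sum_add_distrib, creA_mul, creB_mul, add_smul,
    add_add_add_comm]

theorem annMode_mul (p : K) (V W : NExp n K) :
    (V * W).annMode p = V.annMode p + W.annMode p := by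
  funext k
  simp only [annMode, Pi.add_apply, ← Finset.sum_add_distrib, annA_mul, annB_mul, add_smul,
    add_add_add_comm]

/-- The coefficient of `z ^ j` in the creation exponential of `V`. -/
def cre (V : NExp n K) (j : ℤ) : Module.End K (Sector n K) := expZ K V.creMode j

/-- The coefficient of `z ^ (-j)` in the annihilation exponential of `V`. -/
def ann (p : K) (V : NExp n K) (j : ℤ) : Module.End K (Sector n K) := expZ K (V.annMode p) j

theorem cre_of_neg (V : NExp n K) {j : ℤ} (h : j < 0) : V.cre j = 0 := expZ_of_neg _ h

theorem ann_of_neg (p : K) (V : NExp n K) {j : ℤ} (h : j < 0) : V.ann p j = 0 := expZ_of_neg _ h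

theorem degLE_of_neg {M : ℤ} (hM : M < 0) : degLE n K M = ⊥ := by
  rw [degLE, Submodule.span_eq_bot]
  rintro _ ⟨s, hs, -⟩
  omega

theorem ann_mem_degLE (p : K) (V : NExp n K) (j M : ℤ) {f : Sector n K} (hf : f ∈ degLE n K M) :
    V.ann p j f ∈ degLE n K (M - j) := by
  rcases lt_or_ge j 0 with hj | hj
  · rw [ann_of_neg p V hj]
    exact Submodule.zero_mem _
  lift j to ℕ using hj
  rw [ann, expZ_natCast]
  exact lowers_expCoeff _ (lowers_annMode p V) j M f hf

theorem exists_ann_ann_eq_zero (p : K) (V W : NExp n K) (f : Sector n K) :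
    ∃ B : ℤ, ∀ k l, B < k + l → V.ann p k (W.ann p l f) = 0 := by
  obtain ⟨M, hM⟩ := exists_mem_degLE f
  refine ⟨M, fun k l hk => ?_⟩
  have h := ann_mem_degLE p V k _ (ann_mem_degLE p W l M hM)
  rwa [degLE_of_neg (by omega), Submodule.mem_bot] at h

theorem exists_ann_eq_zero (p : K) (V : NExp n K) (f : Sector n K) :
    ∃ B : ℤ, ∀ k, B < k → V.ann p k f = 0 := by
  obtain ⟨B, hB⟩ := exists_ann_ann_eq_zero p V V f
  refine ⟨B, fun k hk => ?_⟩
  simpa [ann, expZ] using hB k 0 (by omega)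

end NExp

theorem linearMap_finsum_apply {K ι M : Type*} [Field K] [AddCommGroup M] [Module K M]
    {T : ι → Module.End K M} (hT : (Function.support T).Finite) (f : M) :
    (∑ᶠ i, T i) f = ∑ᶠ i, T i f :=
  map_finsum (LinearMap.applyₗ (R := K) (M₂ := M) f) hT

namespace NExp

variable {n : ℕ} {K : Type*} [Field K]

theorem osc_eq_zero (p : K) (V : NExp n K) {d : ℚ} (hd : d ∉ Set.range ((↑) : ℤ → ℚ)) :
    V.osc p d = 0 :=
  LinearMap.ext fun _ => finsum_eq_zero_of_forall_eq_zero fun x => by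
    rw [oscTerm, if_neg, LinearMap.zero_apply]
    exact fun h => hd ⟨x.1 - x.2, by push_cast; exact h⟩

theorem osc_apply (p : K) (V : NExp n K) (d : ℤ) (f : Sector n K) :
    V.osc p d f = ∑ᶠ k : ℤ, V.cre (d + k) (V.ann p k f) := by
  have hterm (x : ℕ × ℕ) : V.oscTerm p d x f =
      if (x.1 : ℤ) = d + x.2 then V.cre (d + x.2) (V.ann p x.2 f) else 0 := by
    have hiff : (x.1 : ℚ) - x.2 = d ↔ (x.1 : ℤ) = d + x.2 := by
      rw [sub_eq_iff_eq_add]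
      exact_mod_cast Iff.rfl
    simp only [oscTerm, hiff]
    split_ifs with h
    · rw [← h, cre, ann, expZ_natCast, expZ_natCast]
      rfl
    · rfl
  change ∑ᶠ x : ℕ × ℕ, V.oscTerm p d x f = _
  rw [← finsum_mem_support, ← finsum_mem_support (f := fun k : ℤ => V.cre (d + k) (V.ann p k f))]
  have hsupp {x : ℕ × ℕ} (hx : x ∈ Function.support fun x => V.oscTerm p d x f) :
      (x.1 : ℤ) = d + x.2 := by
    by_contra hne
    exact hx (by simp only [hterm, if_neg hne])
  refine finsum_mem_eq_of_bijOn (fun x => (x.2 : ℤ)) ⟨fun x hx => ?_, fun x hx y hy hxy => ?_,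
    fun k hk => ?_⟩ fun x hx => by rw [hterm, if_pos (hsupp hx)]
  · have hx' := hsupp hx
    rwa [Function.mem_support, hterm, if_pos hx'] at hx
  · have hx' := hsupp hx
    have hy' := hsupp hy
    have hxy' : (x.2 : ℤ) = y.2 := hxy
    exact Prod.ext (by omega) (by omega)
  · have hk0 : 0 ≤ k := by
      by_contra h
      exact hk (by simp only [ann_of_neg p V (lt_of_not_ge h), LinearMap.zero_apply, map_zero])
    have hdk : 0 ≤ d + k := by
      by_contra h
      exact hk (by simp only [cre_of_neg V (lt_of_not_ge h), LinearMap.zero_apply])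
    refine ⟨((d + k).toNat, k.toNat), ?_, Int.toNat_of_nonneg hk0⟩
    rwa [Function.mem_support, hterm, Int.toNat_of_nonneg hk0, Int.toNat_of_nonneg hdk, if_pos rfl]

theorem finite_support_cre_ann (p : K) (V : NExp n K) (d : ℤ) (f : Sector n K) :
    (Function.support fun k : ℤ => V.cre (d + k) (V.ann p k f)).Finite := by
  obtain ⟨B, hB⟩ := exists_ann_eq_zero p V f
  refine finite_support_of_eq_zero 0 B fun k hk => ?_
  rcases hk with h | h
  · simp [ann_of_neg p V h]
  · simp [hB k h]

/-- The terms of the coefficient of `z ^ d w ^ e` in `∑_m g m (w / z) ^ m :V(z)W(w):`. -/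
def normalTerm (p : K) (V W : NExp n K) (d e : ℤ) (g : ℤ → K) (f : Sector n K)
    (x : ℤ × ℤ × ℤ) : Sector n K :=
  g x.1 • V.cre (d + x.1 + x.2.1) (W.cre (e - x.1 + x.2.2) (V.ann p x.2.1 (W.ann p x.2.2 f)))

theorem finite_support_normalTerm (p : K) (V W : NExp n K) (d e : ℤ) (g : ℤ → K)
    (f : Sector n K) : (Function.support (normalTerm p V W d e g f)).Finite := by
  obtain ⟨B, hB⟩ := exists_ann_ann_eq_zero p V W f
  refine ((Set.finite_Icc (-d - B) (e + B)).prod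
    ((Set.finite_Icc 0 B).prod (Set.finite_Icc 0 B))).subset ?_
  rintro ⟨m, k, l⟩ hx
  have hvanish : k < 0 ∨ l < 0 ∨ B < k + l ∨ d + m + k < 0 ∨ e - m + l < 0 →
      normalTerm p V W d e g f (m, k, l) = 0 := by
    simp only [normalTerm]
    rintro (h | h | h | h | h)
    · simp [ann_of_neg p V h]
    · simp [ann_of_neg p W h]
    · simp [hB k l h]
    · simp [cre_of_neg V h]
    · simp [cre_of_neg W h]
  simp only [Set.mem_prod, Set.mem_Icc]
  have hbounds := mt hvanish hx
  omega

/-- The coefficient of `z ^ d w ^ e` in the oscillator part of `∑_m g m (w / z) ^ m :V(z)W(w):`,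
as a linear function of `g`. -/
def normalSum (p : K) (V W : NExp n K) (d e : ℤ) : (ℤ → K) →ₗ[K] Module.End K (Sector n K) :=
  LinearMap.mk₂ K (fun g f => ∑ᶠ x, normalTerm p V W d e g f x)
    (fun g g' f => by
      rw [← finsum_add_distrib (finite_support_normalTerm ..) (finite_support_normalTerm ..)]
      simp only [normalTerm, Pi.add_apply, add_smul])
    (fun c g f => by simp only [normalTerm, smul_finsum, Pi.smul_apply, smul_assoc])
    (fun g f f' => by
      rw [← finsum_add_distrib (finite_support_normalTerm ..) (finite_support_normalTerm ..)]
      simp only [normalTerm, map_add, smul_add])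
    (fun c g f => by simp only [normalTerm, smul_finsum, map_smul, smul_comm c])

theorem normalSum_apply (p : K) (V W : NExp n K) (d e : ℤ) (g : ℤ → K) (f : Sector n K) :
    normalSum p V W d e g f = ∑ᶠ x, normalTerm p V W d e g f x :=
  rfl

theorem normalSum_sub_one_add_one (p : K) (V W : NExp n K) (d e : ℤ) (g : ℤ → K) :
    normalSum p V W (d - 1) (e + 1) g = normalSum p V W d e fun m => g (m + 1) := by
  refine LinearMap.ext fun f => ?_
  rw [normalSum_apply, normalSum_apply,
    ← finsum_comp_equiv ((Equiv.addRight (1 : ℤ)).prodCongr (Equiv.refl (ℤ × ℤ)))]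
  refine finsum_congr fun x => ?_
  simp only [normalTerm, Equiv.prodCongr_apply, Prod.map, Equiv.coe_addRight, Equiv.refl_apply]
  rw [show d - 1 + (x.1 + 1) = d + x.1 by ring, show e + 1 - (x.1 + 1) = e - x.1 by ring]

theorem ann_cre_apply [CharZero K] (p : K) (V W : NExp n K) (j N : ℤ) (f : Sector n K) :
    V.ann p j (W.cre N f) =
      ∑ᶠ m : ℤ, expZ K (contr p V W) m • W.cre (N - m) (V.ann p (j - m) f) := by
  rw [ann, cre, ← Module.End.mul_apply, expZ_mul_expZ (annMode_commute p V V)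
    (annMode_mul_creMode p V W), linearMap_finsum_apply]
  · rfl
  · refine finite_support_of_eq_zero 0 N fun m hm => ?_
    rcases hm with h | h <;> simp (disch := omega) [expZ_of_neg]

/-- The reindexing `(k, l, m) ↦ (m, k - m, l)`. -/
def wickEquiv : ℤ × ℤ × ℤ ≃ ℤ × ℤ × ℤ where
  toFun x := (x.2.2, x.1 - x.2.2, x.2.1)
  invFun x := (x.2.1 + x.1, x.2.2, x.1)
  left_inv x := by simp
  right_inv x := by simp

theorem osc_mul_osc [CharZero K] (p : K) (V W : NExp n K) (d e : ℤ) :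
    V.osc p d * W.osc p e = normalSum p V W d e (expZ K (contr p V W)) := by
  refine LinearMap.ext fun f => ?_
  rw [normalSum_apply, ← finsum_comp_equiv wickEquiv, finsum_curry₃ _ <|
    (finite_support_normalTerm p V W _ _ _ f).preimage wickEquiv.injective.injOn,
    Module.End.mul_apply, osc_apply]
  refine finsum_congr fun k => ?_
  have hfin := finite_support_cre_ann p W e f
  rw [osc_apply, map_finsum _ hfin, map_finsum _ (hfin.subset fun l => mt fun h => ?_)]
  · refine finsum_congr fun l => ?_
    rw [ann_cre_apply, map_finsum]
    · refine finsum_congr fun m => ?_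
      simp only [map_smul, normalTerm, wickEquiv, Equiv.coe_fn_mk]
      rw [show d + m + (k - m) = d + k by ring, show e - m + l = e + l - m by ring]
    · refine finite_support_of_eq_zero 0 k fun m hm => ?_
      rcases hm with h | h <;> simp (disch := omega) [expZ_of_neg, ann_of_neg]
  · exact (congrArg _ h).trans (map_zero _)

/-- The reindexing `(m, k, l) ↦ (-m, l, k)`. -/
def swapEquiv : ℤ × ℤ × ℤ ≃ ℤ × ℤ × ℤ where
  toFun x := (-x.1, x.2.2, x.2.1)
  invFun x := (-x.1, x.2.2, x.2.1)
  left_inv x := by simp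
  right_inv x := by simp

theorem normalSum_swap (p : K) (V W : NExp n K) (d e : ℤ) (g : ℤ → K) :
    normalSum p W V e d g = normalSum p V W d e fun m => g (-m) := by
  refine LinearMap.ext fun f => ?_
  rw [normalSum_apply, normalSum_apply, ← finsum_comp_equiv swapEquiv]
  refine finsum_congr fun x => ?_
  simp only [normalTerm, swapEquiv, Equiv.coe_fn_mk, ← Module.End.mul_apply, cre, ann]
  rw [(expZ_commute (annMode_commute p W V) _ _).eq, ← mul_assoc,
    (expZ_commute (creMode_commute W V) _ _).eq, mul_assoc, sub_neg_eq_add, ← sub_eq_add_neg]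

end NExp

section Powers

/-- `¼ ℤ`, the exponents `x` for which `q ^ x` is an integral power of `p = q ^ (1/4)`. -/
def quarterIntegers : AddSubgroup ℚ := AddSubgroup.zmultiples (1 / 4)

theorem mem_quarterIntegers {x : ℚ} : x ∈ quarterIntegers ↔ ∃ m : ℤ, 4 * x = m := by
  simp only [quarterIntegers, AddSubgroup.mem_zmultiples_iff, zsmul_eq_mul]
  exact exists_congr fun m => ⟨fun h => by linarith, fun h => by linarith⟩

theorem intCast_mem_quarterIntegers (m : ℤ) : (m : ℚ) ∈ quarterIntegers :=
  mem_quarterIntegers.2 ⟨4 * m, by push_cast; ring⟩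

theorem intCast_div_two_mem_quarterIntegers (m : ℤ) : (m : ℚ) / 2 ∈ quarterIntegers :=
  mem_quarterIntegers.2 ⟨2 * m, by push_cast; ring⟩

theorem half_mem_quarterIntegers : (1 / 2 : ℚ) ∈ quarterIntegers := by
  simpa using intCast_div_two_mem_quarterIntegers 1

theorem natCast_add_half_mem_quarterIntegers (n : ℕ) : (n : ℚ) + 1 / 2 ∈ quarterIntegers :=
  add_mem (by simpa using intCast_mem_quarterIntegers n) half_mem_quarterIntegers

variable {K : Type*} [Field K] {p : K}

theorem qpow_eq_zpow {x : ℚ} {m : ℤ} (h : 4 * x = m) : qpow p x = p ^ m := by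
  rw [qpow, h, Int.floor_intCast]

theorem qpow_add (hp0 : p ≠ 0) {x : ℚ} (hx : x ∈ quarterIntegers) (y : ℚ) :
    qpow p (x + y) = qpow p x * qpow p y := by
  obtain ⟨m, hm⟩ := mem_quarterIntegers.1 hx
  rw [qpow_eq_zpow hm, qpow, qpow, mul_add, hm, Int.floor_intCast_add, zpow_add₀ hp0]

theorem qpow_zero (p : K) : qpow p 0 = 1 := by simp [qpow]

theorem qpow_ne_zero (hp0 : p ≠ 0) (x : ℚ) : qpow p x ≠ 0 := zpow_ne_zero _ hp0

theorem qpow_mul_intCast {x : ℚ} (hx : x ∈ quarterIntegers) (k : ℤ) :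
    qpow p (x * k) = qpow p x ^ k := by
  obtain ⟨m, hm⟩ := mem_quarterIntegers.1 hx
  rw [qpow_eq_zpow hm, qpow_eq_zpow (m := m * k) (by push_cast; rw [← hm]; ring), zpow_mul]

theorem qpow_mul_natCast {x : ℚ} (hx : x ∈ quarterIntegers) (k : ℕ) :
    qpow p (x * k) = qpow p x ^ k := by
  simpa using qpow_mul_intCast (p := p) hx k

theorem qpow_neg {x : ℚ} (hx : x ∈ quarterIntegers) : qpow p (-x) = (qpow p x)⁻¹ := by
  simpa using qpow_mul_intCast (p := p) hx (-1)

theorem qpow_sub (hp0 : p ≠ 0) (x : ℚ) {y : ℚ} (hy : y ∈ quarterIntegers) :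
    qpow p (x - y) = qpow p x / qpow p y := by
  rw [sub_eq_neg_add, qpow_add hp0 (neg_mem hy), qpow_neg hy, inv_mul_eq_div]

theorem qpow_sub_qpow_neg_ne_zero (hp0 : p ≠ 0) (hp : ∀ k : ℕ, 0 < k → p ^ k ≠ 1) {x : ℚ}
    (hx : x ∈ quarterIntegers) (hx0 : x ≠ 0) : qpow p x - qpow p (-x) ≠ 0 := by
  obtain ⟨m, hm⟩ := mem_quarterIntegers.1 hx
  have hm0 : m ≠ 0 := by
    rintro rfl
    exact hx0 (by simpa using hm)
  rw [sub_ne_zero, qpow_neg hx, qpow_eq_zpow hm, ne_eq,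
    ← mul_eq_one_iff_eq_inv₀ (zpow_ne_zero m hp0),
    ← zpow_add₀ hp0]
  have hnatAbs := hp (m + m).natAbs (by omega)
  rcases Int.natAbs_eq (m + m) with h | h <;> rw [h]
  · rwa [zpow_natCast]
  · rwa [zpow_neg, zpow_natCast, inv_eq_one]

theorem qnum_ne_zero (hp0 : p ≠ 0) (hp : ∀ k : ℕ, 0 < k → p ^ k ≠ 1) {x : ℚ}
    (hx : x ∈ quarterIntegers) (hx0 : x ≠ 0) : qnum p x ≠ 0 :=
  div_ne_zero (qpow_sub_qpow_neg_ne_zero hp0 hp hx hx0)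
    (qpow_sub_qpow_neg_ne_zero hp0 hp (by simpa using intCast_mem_quarterIntegers 1) one_ne_zero)

theorem qnum_zero (p : K) : qnum p 0 = 0 := by simp [qnum]

theorem qnum_neg (p : K) (x : ℚ) : qnum p (-x) = -qnum p x := by
  rw [qnum, qnum, neg_neg, ← neg_div, neg_sub]

end Powers

section Form

variable {n : ℕ}

theorem form_comm (x y : Fin n → ℚ) : form x y = form y x := by
  simp only [form, mul_comm]

theorem form_add (x y z : Fin n → ℚ) : form x (y + z) = form x y + form x z := by
  simp only [form, Pi.add_apply, mul_add, add_div, Finset.sum_add_distrib]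

theorem form_toRat_sub (x : Fin n → ℚ) (y z : Fin n → ℤ) :
    form x (toRat (y - z)) = form x (toRat y) - form x (toRat z) := by
  simp only [form, toRat, Pi.sub_apply, Int.cast_sub, mul_sub, sub_div, Finset.sum_sub_distrib]

theorem form_toRat_smul (x : Fin n → ℚ) (s : ℤ) (y : Fin n → ℤ) :
    form x (toRat (s • y)) = s * form x (toRat y) := by
  simp only [form, toRat, Pi.smul_apply, smul_eq_mul, Int.cast_mul, Finset.mul_sum, mul_div_assoc,
    mul_left_comm]

theorem form_toRat_zero (x : Fin n → ℚ) : form x (toRat 0) = 0 := by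
  simp [form, toRat]

theorem form_toRat_eps (x : Fin n → ℚ) (k : Fin n) : form x (toRat (eps n (k + 1))) = x k / 2 := by
  simp [form, toRat, eps, Fin.val_inj, ite_div]

theorem form_eps (i j : ℕ) :
    form (toRat (eps n i)) (toRat (eps n j)) = if i = j ∧ 1 ≤ i ∧ i ≤ n then 1 / 2 else 0 := by
  by_cases hj : 1 ≤ j ∧ j ≤ n
  · obtain ⟨k, rfl⟩ : ∃ k : Fin n, (k : ℕ) + 1 = j := ⟨⟨j - 1, by omega⟩, by simp; omega⟩
    rw [form_toRat_eps, toRat, eps]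
    split_ifs <;> first | omega | simp
  · rw [if_neg (by omega), form, Finset.sum_eq_zero]
    intro k _
    rw [toRat, toRat, eps, eps, if_neg (c := (k : ℕ) + 1 = j) (by omega)]
    simp

theorem form_root (x : Fin n → ℚ) (j : ℕ) :
    form x (toRat (root n j)) =
      if j < n then form x (toRat (eps n j)) - form x (toRat (eps n (j + 1)))
      else 2 * form x (toRat (eps n n)) := by
  unfold root
  split_ifs
  · exact form_toRat_sub _ _ _
  · exact_mod_cast form_toRat_smul x 2 (eps n n)

theorem form_eps_one_root {i : ℕ} (hn : 2 ≤ n) (hi : 1 ≤ i) :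
    form (toRat (eps n 1)) (toRat (root n i)) = if i = 1 then 1 / 2 else 0 := by
  simp only [form_root, form_eps]
  split_ifs <;> first | omega | norm_num

theorem form_root_root {i j : ℕ} (hi : 1 ≤ i) (hin : i ≤ n) (hj : 1 ≤ j) (hjn : j ≤ n) :
    form (toRat (root n i)) (toRat (root n j)) =
      if i = j then (if i < n then 1 else 2) else
      if i + 1 = j then (if j < n then -1 / 2 else -1) else
      if j + 1 = i then (if i < n then -1 / 2 else -1) else 0 := by
  rw [form_root]
  simp only [form_comm (toRat (root n i)), form_root, form_eps, hi.trans hin, le_refl, and_true]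
  split_ifs <;> first | omega | norm_num

theorem fundWt_one : fundWt n 1 = eps n 1 := by simp [fundWt]

end Form

/-- The label of the sector to which `e ^ (a, b)` maps the sector labelled `w`. -/
def Charge.shift {n : ℕ} (w : Charge n) (a b : Fin n → ℤ) : Charge n := (w.1, w.2.1 + a, w.2.2 + b)

theorem Charge.shift_shift {n : ℕ} (w : Charge n) (a b a' b' : Fin n → ℤ) :
    (w.shift a b).shift a' b' = w.shift (a + a') (b + b') := by
  simp only [shift, add_assoc]

theorem Charge.shift_al {n : ℕ} (w : Charge n) (a b : Fin n → ℤ) :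
    (w.shift a b).al = w.al + toRat a := by
  funext k
  simp only [al, shift, toRat, Pi.add_apply, Int.cast_add]
  exact add_right_comm _ _ _

theorem Charge.shift_be {n : ℕ} (w : Charge n) (a b : Fin n → ℤ) :
    (w.shift a b).be = w.be + toRat b := by
  funext k
  simp only [be, shift, toRat, Pi.add_apply, Int.cast_add]

theorem fock_end_ext {n : ℕ} {K : Type*} [Field K] {S T : Module.End K (Fock n K)}
    (h : ∀ w f, S (Finsupp.single w f) = T (Finsupp.single w f)) : S = T :=
  Finsupp.lhom_ext h

namespace NExp

variable {n : ℕ} {K : Type*} [Field K]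

theorem series_single (p : K) (V : NExp n K) (r : ℚ) (w : Charge n) (f : Sector n K) :
    V.series p r (Finsupp.single w f) =
      Finsupp.single (w.shift V.shA V.shB) (V.scal w • V.osc p (r - V.pow w) f) := by
  simp [series, Charge.shift]

/-- `normalSum` with rational exponents: only integral powers of `z` and `w` occur in the
oscillator part. -/
def normalCoeff (p : K) (V W : NExp n K) (d e : ℚ) : (ℤ → K) →ₗ[K] Module.End K (Sector n K) :=
  open Classical in
  if d ∈ Set.range ((↑) : ℤ → ℚ) ∧ e ∈ Set.range ((↑) : ℤ → ℚ) then
    normalSum p V W ⌊d⌋ ⌊e⌋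
  else 0

theorem normalCoeff_intCast (p : K) (V W : NExp n K) (d e : ℤ) :
    normalCoeff p V W d e = normalSum p V W d e := by
  rw [normalCoeff, if_pos ⟨⟨d, rfl⟩, e, rfl⟩, Int.floor_intCast, Int.floor_intCast]

theorem normalCoeff_of_notMem (p : K) (V W : NExp n K) {d e : ℚ}
    (h : ¬(d ∈ Set.range ((↑) : ℤ → ℚ) ∧ e ∈ Set.range ((↑) : ℤ → ℚ))) :
    normalCoeff p V W d e = 0 :=
  if_neg h

theorem osc_mul_osc_eq_normalCoeff [CharZero K] (p : K) (V W : NExp n K) (d e : ℚ) :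
    V.osc p d * W.osc p e = normalCoeff p V W d e (expZ K (contr p V W)) := by
  by_cases h : d ∈ Set.range ((↑) : ℤ → ℚ) ∧ e ∈ Set.range ((↑) : ℤ → ℚ)
  · obtain ⟨⟨d, rfl⟩, e, rfl⟩ := h
    rw [normalCoeff_intCast, osc_mul_osc]
  · rw [normalCoeff_of_notMem p V W h, LinearMap.zero_apply]
    rcases not_and_or.1 h with hd | he
    · rw [osc_eq_zero p V hd, zero_mul]
    · rw [osc_eq_zero p W he, mul_zero]

theorem normalCoeff_swap (p : K) (V W : NExp n K) (d e : ℚ) (g : ℤ → K) :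
    normalCoeff p W V e d g = normalCoeff p V W d e fun m => g (-m) := by
  by_cases h : d ∈ Set.range ((↑) : ℤ → ℚ) ∧ e ∈ Set.range ((↑) : ℤ → ℚ)
  · obtain ⟨⟨d, rfl⟩, e, rfl⟩ := h
    rw [normalCoeff_intCast, normalCoeff_intCast, normalSum_swap]
  · rw [normalCoeff_of_notMem p V W h, normalCoeff_of_notMem p W V (mt And.symm h)]
    rfl

theorem normalCoeff_sub_one_add_one (p : K) (V W : NExp n K) (d e : ℚ) (g : ℤ → K) :
    normalCoeff p V W (d - 1) (e + 1) g = normalCoeff p V W d e fun m => g (m + 1) := by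
  by_cases h : d ∈ Set.range ((↑) : ℤ → ℚ) ∧ e ∈ Set.range ((↑) : ℤ → ℚ)
  · obtain ⟨⟨d, rfl⟩, e, rfl⟩ := h
    have hcast := normalCoeff_intCast p V W (d - 1) (e + 1)
    push_cast at hcast
    rw [hcast, normalCoeff_intCast, normalSum_sub_one_add_one]
  · rw [normalCoeff_of_notMem p V W h, normalCoeff_of_notMem p V W]
    · rfl
    · rintro ⟨⟨d', hd⟩, e', he⟩
      exact h ⟨⟨d' + 1, by push_cast; linarith⟩, e' - 1, by push_cast; linarith⟩

/-- The coefficient of `z ^ r w ^ s` in `∑_m g m (w / z) ^ m :V(z)W(w):`, as a linear function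
of `g`. -/
def normalSeries (p : K) (V W : NExp n K) (r s : ℚ) : (ℤ → K) →ₗ[K] Module.End K (Fock n K) where
  toFun g := Finsupp.lsum K fun w =>
    Finsupp.lsingle (w.shift (V.shA + W.shA) (V.shB + W.shB)) ∘ₗ
      ((V.scal w * W.scal w) • normalCoeff p V W (r - V.pow w) (s - W.pow w) g)
  map_add' g g' := fock_end_ext fun w f => by simp
  map_smul' c g := fock_end_ext fun w f => by simp [smul_comm c]

theorem normalSeries_single (p : K) (V W : NExp n K) (r s : ℚ) (g : ℤ → K) (w : Charge n)
    (f : Sector n K) :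
    normalSeries p V W r s g (Finsupp.single w f) =
      Finsupp.single (w.shift (V.shA + W.shA) (V.shB + W.shB))
        ((V.scal w * W.scal w) • normalCoeff p V W (r - V.pow w) (s - W.pow w) g f) := by
  simp [normalSeries]

theorem normalSeries_sub_one_add_one (p : K) (V W : NExp n K) (r s : ℚ) (g : ℤ → K) :
    normalSeries p V W (r - 1) (s + 1) g = normalSeries p V W r s fun m => g (m + 1) := by
  refine fock_end_ext fun w f => ?_
  rw [normalSeries_single, normalSeries_single, sub_right_comm, ← sub_add_eq_add_sub,
    normalCoeff_sub_one_add_one]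

theorem normalSeries_swap (p : K) (V W : NExp n K) (r s : ℚ) (g : ℤ → K) :
    normalSeries p W V s r g = normalSeries p V W r s fun m => g (-m) := by
  refine fock_end_ext fun w f => ?_
  rw [normalSeries_single, normalSeries_single, normalCoeff_swap, mul_comm (W.scal w),
    add_comm W.shA, add_comm W.shB]

/-! #### Contractions -/

/-- The modes of `V` and `W` have the commutators `c`, and moving the zero modes of `V(z)` through
the translation `e ^ γ` of `W(w)` produces the factor `κ z ^ t`. -/
structure HasContraction (p : K) (V W : NExp n K) (c : ℕ+ → K) (t : ℚ) (κ : K) : Prop where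
  contr_eq : contr p V W = c
  pow_shift : ∀ w : Charge n, V.pow (w.shift W.shA W.shB) = V.pow w + t
  scal_shift : ∀ w : Charge n, V.scal (w.shift W.shA W.shB) = κ * V.scal w

theorem contr_mul_left (p : K) (V V' W : NExp n K) :
    contr p (V * V') W = contr p V W + contr p V' W := by
  funext k
  simp only [contr, annA_mul, annB_mul, Pi.add_apply, add_mul, Finset.sum_add_distrib]
  exact add_add_add_comm _ _ _ _

theorem contr_mul_right (p : K) (V W W' : NExp n K) :
    contr p V (W * W') = contr p V W + contr p V W' := by
  funext k
  simp only [contr, creA_mul, creB_mul, Pi.add_apply, mul_add, add_mul, Finset.sum_add_distrib]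
  exact add_add_add_comm _ _ _ _

variable {p : K} {V V' W W' : NExp n K} {c c' : ℕ+ → K} {t t' : ℚ} {κ κ' : K}

theorem HasContraction.mul_left (h : HasContraction p V W c t κ)
    (h' : HasContraction p V' W c' t' κ') :
    HasContraction p (V * V') W (c + c') (t + t') (κ * κ') where
  contr_eq := by rw [contr_mul_left, h.contr_eq, h'.contr_eq]
  pow_shift w := by
    simp only [NExp.pow_mul, Pi.add_apply, h.pow_shift, h'.pow_shift, add_add_add_comm]
  scal_shift w := by
    simp only [scal_mul, Pi.mul_apply, h.scal_shift, h'.scal_shift, mul_mul_mul_comm]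

theorem HasContraction.mul_right (h : HasContraction p V W c t κ)
    (h' : HasContraction p V W' c' t' κ') :
    HasContraction p V (W * W') (c + c') (t + t') (κ * κ') where
  contr_eq := by rw [contr_mul_right, h.contr_eq, h'.contr_eq]
  pow_shift w := by
    rw [shA_mul, shB_mul, ← Charge.shift_shift, h'.pow_shift, h.pow_shift, add_assoc]
  scal_shift w := by
    rw [shA_mul, shB_mul, ← Charge.shift_shift, h'.scal_shift, h.scal_shift]
    ring

theorem HasContraction.series_mul_series [CharZero K] (h : HasContraction p V W c 0 κ) (r s : ℚ) :
    V.series p r * W.series p s = normalSeries p V W r s (κ • expZ K c) := by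
  refine fock_end_ext fun w f => ?_
  rw [Module.End.mul_apply, series_single, series_single, Charge.shift_shift, h.pow_shift,
    h.scal_shift, add_zero, map_smul, ← Module.End.mul_apply, osc_mul_osc_eq_normalCoeff,
    h.contr_eq, normalSeries_single, add_comm W.shA, add_comm W.shB, map_smul, LinearMap.smul_apply,
    smul_smul, smul_smul]
  congr 2
  ring

/-- The coefficient of `(w / z) ^ m` in the scalar factor of `[V(z), W(w)]_v`. -/
def commFactor (v : K) (c c' : ℕ+ → K) (κ κ' : K) (m : ℤ) : K :=
  κ * expZ K c m - v * (κ' * expZ K c' (-m))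

theorem qcomm_eq_normalSeries [CharZero K] (hVW : HasContraction p V W c 0 κ)
    (hWV : HasContraction p W V c' 0 κ') (v : K) (r s : ℚ) :
    qcomm v (V.series p) (W.series p) r s = normalSeries p V W r s (commFactor v c c' κ κ') := by
  rw [qcomm, hVW.series_mul_series, hWV.series_mul_series, normalSeries_swap p V W,
    ← map_smul]
  exact (map_sub (normalSeries p V W r s) _ _).symm

theorem qcomm_eq_smul_mulZdivW [CharZero K] (hVW : HasContraction p V W c 0 κ)
    (hWV : HasContraction p W V c' 0 κ') {v v' x : K}
    (h : ∀ m, commFactor v c c' κ κ' m = x * commFactor v' c c' κ κ' (m + 1)) :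
    qcomm v (V.series p) (W.series p) = x • mulZdivW (qcomm v' (V.series p) (W.series p)) := by
  funext r s
  simp only [Pi.smul_apply, mulZdivW]
  rw [qcomm_eq_normalSeries hVW hWV, qcomm_eq_normalSeries hVW hWV, normalSeries_sub_one_add_one,
    ← map_smul]
  exact congrArg _ (funext h)

/-- The modes of `V` and `W` commute, and moving the zero modes of one series through the
translation of the other produces no factor, so that the operators `V(z)` and `W(w)` commute. -/
structure Uncoupled (p : K) (V W : NExp n K) : Prop where
  left : HasContraction p V W 0 0 1
  right : HasContraction p W V 0 0 1

theorem Uncoupled.symm (h : Uncoupled p V W) : Uncoupled p W V := ⟨h.right, h.left⟩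

theorem Uncoupled.mul_right (h : Uncoupled p V W) (h' : Uncoupled p V W') :
    Uncoupled p V (W * W') where
  left := by simpa only [add_zero, mul_one] using h.left.mul_right h'.left
  right := by simpa only [add_zero, mul_one] using h.right.mul_left h'.right

theorem Uncoupled.mul_left (h : Uncoupled p V W) (h' : Uncoupled p V' W) :
    Uncoupled p (V * V') W :=
  (h.symm.mul_right h'.symm).symm

theorem Uncoupled.commute_series [CharZero K] (h : Uncoupled p V W) (r s : ℚ) :
    Commute (V.series p r) (W.series p s) := by
  rw [commute_iff_eq, h.left.series_mul_series, h.right.series_mul_series, normalSeries_swap p V W]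
  congr 1
  funext m
  simp [expZ_zero]

/-! #### Dilations -/

/-- `V(q ^ ℓ z)`. -/
def dilate (p : K) (ℓ : ℚ) (V : NExp n K) : NExp n K where
  creA k j := qpow p (ℓ * (k : ℕ)) * V.creA k j
  creB k j := qpow p (ℓ * (k : ℕ)) * V.creB k j
  annA k j := qpow p (-(ℓ * (k : ℕ))) * V.annA k j
  annB k j := qpow p (-(ℓ * (k : ℕ))) * V.annB k j
  shA := V.shA
  shB := V.shB
  scal w := qpow p (ℓ * V.pow w) * V.scal w
  pow := V.pow

theorem dilate_mul (hp0 : p ≠ 0) {ℓ : ℚ} {V : NExp n K}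
    (hV : ∀ w, ℓ * V.pow w ∈ quarterIntegers) (W : NExp n K) :
    (V * W).dilate p ℓ = V.dilate p ℓ * W.dilate p ℓ := by
  ext1 <;> simp only [dilate, creA_mul, creB_mul, annA_mul, annB_mul, shA_mul, shB_mul, scal_mul,
    NExp.pow_mul]
  case scal =>
    funext w
    simp only [Pi.add_apply, Pi.mul_apply, mul_add, qpow_add hp0 (hV w)]
    ring
  all_goals
    funext k j
    simp only [Pi.add_apply, mul_add]

theorem creMode_dilate {ℓ : ℚ} (hℓ : ℓ ∈ quarterIntegers) (V : NExp n K) :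
    (V.dilate p ℓ).creMode = fun k : ℕ+ => qpow p ℓ ^ (k : ℕ) • V.creMode k := by
  funext k
  simp only [creMode, dilate, qpow_mul_natCast hℓ, Finset.smul_sum, smul_add, smul_smul]

theorem annMode_dilate {ℓ : ℚ} (hℓ : ℓ ∈ quarterIntegers) (V : NExp n K) :
    (V.dilate p ℓ).annMode p = fun k : ℕ+ => (qpow p ℓ)⁻¹ ^ (k : ℕ) • V.annMode p k := by
  funext k
  simp only [annMode, dilate, ← neg_mul, qpow_mul_natCast (neg_mem hℓ), qpow_neg hℓ,
    Finset.smul_sum, smul_add, smul_smul]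

theorem cre_mul_dilate [CharZero K] {ℓ : ℚ} (hℓ : ℓ ∈ quarterIntegers) (V W : NExp n K) (N : ℤ)
    (f : Sector n K) :
    (V * W.dilate p ℓ).cre N f = ∑ᶠ b : ℤ, qpow p ℓ ^ b • V.cre (N - b) (W.cre b f) := by
  rw [cre, creMode_mul, expZ_add (creMode_commute V V) (creMode_commute _ _)
    (creMode_commute V _), linearMap_finsum_apply]
  · refine finsum_congr fun b => ?_
    rw [creMode_dilate hℓ, expZ_smul_pow, mul_smul_comm]
    rfl
  · refine finite_support_of_eq_zero 0 N fun m hm => ?_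
    rcases hm with h | h <;> simp (disch := omega) [expZ_of_neg]

theorem ann_mul_dilate [CharZero K] {ℓ : ℚ} (hℓ : ℓ ∈ quarterIntegers) (V W : NExp n K) (N : ℤ)
    (f : Sector n K) :
    (V * W.dilate p ℓ).ann p N f =
      ∑ᶠ l : ℤ, (qpow p ℓ)⁻¹ ^ l • V.ann p (N - l) (W.ann p l f) := by
  rw [ann, annMode_mul, expZ_add (annMode_commute p V V) (annMode_commute p _ _)
    (annMode_commute p V _), linearMap_finsum_apply]
  · refine finsum_congr fun b => ?_
    rw [annMode_dilate hℓ, expZ_smul_pow, mul_smul_comm]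
    rfl
  · refine finite_support_of_eq_zero 0 N fun m hm => ?_
    rcases hm with h | h <;> simp (disch := omega) [expZ_of_neg]

/-- The reindexing `(N, b, l) ↦ (e + l - b, N - l, l)`. -/
def deltaEquiv (e : ℤ) : ℤ × ℤ × ℤ ≃ ℤ × ℤ × ℤ where
  toFun x := (e + x.2.2 - x.2.1, x.1 - x.2.2, x.2.2)
  invFun x := (x.2.1 + x.2.2, e + x.2.2 - x.1, x.2.2)
  left_inv x := by simp
  right_inv x := by simp

theorem normalSum_delta [CharZero K] (hp0 : p ≠ 0) {ℓ : ℚ} (hℓ : ℓ ∈ quarterIntegers)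
    (V W : NExp n K) (d e : ℤ) :
    normalSum p V W d e (fun m => (qpow p ℓ)⁻¹ ^ m) =
      (qpow p ℓ)⁻¹ ^ e • (V * W.dilate p ℓ).osc p (d + e : ℤ) := by
  refine LinearMap.ext fun f => ?_
  have hu : (qpow p ℓ)⁻¹ ≠ 0 := inv_ne_zero (qpow_ne_zero hp0 ℓ)
  rw [normalSum_apply, ← finsum_comp_equiv (deltaEquiv e), finsum_curry₃ _ <|
    (finite_support_normalTerm p V W d e _ f).preimage (deltaEquiv e).injective.injOn,
    LinearMap.smul_apply, osc_apply, smul_finsum]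
  refine finsum_congr fun N => ?_
  rw [cre_mul_dilate hℓ, smul_finsum]
  refine finsum_congr fun b => ?_
  rw [ann_mul_dilate hℓ, map_finsum, map_finsum, smul_finsum, smul_finsum]
  · refine finsum_congr fun l => ?_
    simp only [normalTerm, deltaEquiv, Equiv.coe_fn_mk, map_smul, smul_smul]
    rw [show d + (e + l - b) + (N - l) = d + e + N - b by ring,
      show e - (e + l - b) + l = b by ring, zpow_sub₀ hu, zpow_add₀ hu, inv_zpow _ b,
      div_inv_eq_mul,
      mul_right_comm, mul_assoc]
  all_goals
    refine finite_support_of_eq_zero 0 N fun m hm => ?_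
    rcases hm with h | h <;> simp (disch := omega) [ann_of_neg]

theorem normalSeries_delta_single [CharZero K] (hp0 : p ≠ 0) {ℓ : ℚ} (hℓ : ℓ ∈ quarterIntegers)
    (V W : NExp n K) {r s : ℚ} {w : Charge n} {d e : ℤ} (hd : r - V.pow w = d)
    (he : s - W.pow w = e) (f : Sector n K) :
    normalSeries p V W r s (fun m => (qpow p ℓ)⁻¹ ^ m) (Finsupp.single w f) =
      (qpow p (ℓ * s))⁻¹ • (V * W.dilate p ℓ).series p (r + s) (Finsupp.single w f) := by
  have hs : qpow p (ℓ * s) = qpow p ℓ ^ e * qpow p (ℓ * W.pow w) := by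
    rw [← qpow_mul_intCast hℓ, ← qpow_add hp0, ← mul_add, ← he, sub_add_cancel]
    exact mul_comm ℓ (e : ℚ) ▸ zsmul_eq_mul ℓ e ▸ zsmul_mem hℓ e
  have hde : r + s - (V * W.dilate p ℓ).pow w = (d + e : ℤ) := by
    rw [NExp.pow_mul, Pi.add_apply, dilate]
    push_cast
    linarith
  rw [normalSeries_single, series_single, hd, he, hde, normalCoeff_intCast, normalSum_delta hp0 hℓ,
    hs, Finsupp.smul_single, LinearMap.smul_apply, smul_smul, smul_smul]
  congr 2
  have hpow := qpow_ne_zero hp0 (ℓ * W.pow w)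
  simp only [scal_mul, dilate, Pi.mul_apply, inv_zpow]
  field_simp

theorem normalSeries_delta_congr [CharZero K] (hp0 : p ≠ 0) {ℓ : ℚ} (hℓ : ℓ ∈ quarterIntegers)
    (hV : V.pow = V'.pow) (hVW : V * W.dilate p ℓ = V' * W'.dilate p ℓ) (r s : ℚ) :
    normalSeries p V W r s (fun m => (qpow p ℓ)⁻¹ ^ m) =
      normalSeries p V' W' r s (fun m => (qpow p ℓ)⁻¹ ^ m) := by
  have hW : W.pow = W'.pow := add_left_cancel ((congrArg NExp.pow hVW).trans (by rw [hV]; rfl))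
  refine fock_end_ext fun w f => ?_
  by_cases h : r - V.pow w ∈ Set.range ((↑) : ℤ → ℚ) ∧ s - W.pow w ∈ Set.range ((↑) : ℤ → ℚ)
  · obtain ⟨⟨d, hd⟩, e, he⟩ := h
    rw [normalSeries_delta_single hp0 hℓ V W hd.symm he.symm,
      normalSeries_delta_single hp0 hℓ V' W' (hV ▸ hd.symm) (hW ▸ he.symm), hVW]
  · rw [normalSeries_single, normalSeries_single, normalCoeff_of_notMem p V W h,
      normalCoeff_of_notMem p V' W' (by rwa [← hV, ← hW])]
    simp

end NExp

section Duality

variable {n : ℕ} {K : Type*} [Field K] {p : K}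

theorem intCast_mul_mem_quarterIntegers {x : ℚ} (hx : x ∈ quarterIntegers) (N : ℤ) :
    N * x ∈ quarterIntegers :=
  zsmul_eq_mul x N ▸ zsmul_mem hx N

/-- `q ^ x + q ^ (-x)`, the ratio of `[2 x]` and `[x]`. -/
def qsum (p : K) (x : ℚ) : K := qpow p x + qpow p (-x)

theorem qnum_two_mul (hp0 : p ≠ 0) {x : ℚ} (hx : x ∈ quarterIntegers) :
    qnum p (2 * x) = qnum p x * qsum p x := by
  rw [qnum, qnum, qsum, two_mul, neg_add, qpow_add hp0 hx, qpow_add hp0 (neg_mem hx)]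
  ring

theorem qsum_mul_qsum (hp0 : p ≠ 0) {x y : ℚ} (hx : x ∈ quarterIntegers) :
    qsum p x * qsum p y = qsum p (x + y) + qsum p (x - y) := by
  simp only [qsum, neg_add, sub_eq_add_neg, neg_neg,
    qpow_add hp0 hx, qpow_add hp0 (neg_mem hx)]
  ring

/-- The factor of the coefficient of `a_{a+1}(m)` in `a_{\bar 1}(m)` that depends on `a`,
with `x = m / 2`. -/
def abarWeight (p : K) (n : ℕ) (x : ℚ) (a : ℕ) : K :=
  if a + 1 < n then qsum p ((n - a) * x) else 1

theorem abarWeight_mul_qnum_form_self (hp0 : p ≠ 0) {x : ℚ} (hx : x ∈ quarterIntegers) {a : ℕ}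
    (ha : a + 1 < n) :
    abarWeight p n x a *
        qnum p (2 * x * form (toRat (root n (a + 1))) (toRat (root n (a + 1)))) =
      qnum p x * (qsum p ((n - a + 1) * x) + qsum p ((n - a - 1) * x)) := by
  have hmul := qsum_mul_qsum hp0 (y := x) (intCast_mul_mem_quarterIntegers hx (n - a))
  push_cast at hmul
  rw [form_root_root (by omega) (by omega) (by omega) (by omega), if_pos rfl, if_pos ha,
    abarWeight, if_pos ha, mul_one, qnum_two_mul hp0 hx, mul_left_comm, hmul, add_one_mul,
    sub_one_mul]

theorem abarWeight_mul_qnum_form_succ (hp0 : p ≠ 0) {x : ℚ} (hx : x ∈ quarterIntegers) {a : ℕ}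
    (ha : a + 1 < n) :
    abarWeight p n x (a + 1) *
        qnum p (2 * x * form (toRat (root n (a + 1 + 1))) (toRat (root n (a + 1)))) =
      -(qnum p x * qsum p ((n - a - 1) * x)) := by
  rw [form_root_root (by omega) (by omega) (by omega) (by omega), if_neg (by omega),
    if_neg (by omega), if_pos rfl, abarWeight]
  split_ifs with h
  · rw [show 2 * x * (-1 / 2) = -x by ring, qnum_neg]
    push_cast
    rw [sub_add_eq_sub_sub]
    ring
  · obtain rfl : n = a + 2 := by omega
    rw [mul_neg_one, qnum_neg, qnum_two_mul hp0 hx, one_mul]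
    congr 3
    push_cast
    ring

theorem abarWeight_mul_qnum_form_pred (hp0 : p ≠ 0) {x : ℚ} (hx : x ∈ quarterIntegers) {a : ℕ}
    (ha : a + 1 < n) :
    abarWeight p n x a *
        qnum p (2 * x * form (toRat (root n (a + 1))) (toRat (root n (a + 1 + 1)))) =
      -(qnum p x * qsum p ((n - a) * x)) * if a + 2 < n then 1 else qsum p x := by
  rw [form_root_root (by omega) (by omega) (by omega) (by omega), if_neg (by omega), if_pos rfl,
    abarWeight, if_pos ha]
  split_ifs with h
  · rw [show 2 * x * (-1 / 2) = -x by ring, qnum_neg]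
    ring
  · rw [mul_neg_one, qnum_neg, qnum_two_mul hp0 hx]
    ring

theorem qnum_form_eq_zero (x : ℚ) {a j : ℕ} (ha : a < n) (hj : j < n)
    (haj : a + 1 < j ∨ j + 1 < a) :
    qnum p (2 * x * form (toRat (root n (a + 1))) (toRat (root n (j + 1)))) = 0 := by
  rw [form_root_root (by omega) (by omega) (by omega) (by omega), if_neg (by omega),
    if_neg (by omega), if_neg (by omega), mul_zero, qnum_zero]

theorem sum_abarWeight_mul_qnum_form_one (hp0 : p ≠ 0) {x : ℚ} (hx : x ∈ quarterIntegers)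
    (hn : 2 ≤ n) :
    ∑ a ∈ Finset.range n, abarWeight p n x a *
        qnum p (2 * x * form (toRat (root n (a + 1))) (toRat (root n 1))) =
      qnum p x * qsum p ((n + 1) * x) := by
  rw [← Finset.sum_subset (Finset.range_mono hn), Finset.sum_range_succ, Finset.sum_range_one,
    abarWeight_mul_qnum_form_self hp0 hx (by omega), abarWeight_mul_qnum_form_succ hp0 hx hn,
    Nat.cast_zero, sub_zero]
  · ring
  · intro a ha ha'
    simp only [Finset.mem_range] at ha ha'
    rw [qnum_form_eq_zero x (j := 0) ha (by omega) (by omega), mul_zero]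

theorem sum_abarWeight_mul_qnum_form_add_two (hp0 : p ≠ 0) {x : ℚ} (hx : x ∈ quarterIntegers)
    {i : ℕ} (hi : i + 2 ≤ n) :
    ∑ a ∈ Finset.range n, abarWeight p n x a *
        qnum p (2 * x * form (toRat (root n (a + 1))) (toRat (root n (i + 2)))) = 0 := by
  have hpred := abarWeight_mul_qnum_form_pred hp0 hx hi
  have hzero : ∀ a < n, a + 1 < i + 1 ∨ i + 1 + 1 < a → abarWeight p n x a *
      qnum p (2 * x * form (toRat (root n (a + 1))) (toRat (root n (i + 1 + 1)))) = 0 :=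
    fun a ha hai => by rw [qnum_form_eq_zero x ha (by omega) hai, mul_zero]
  have hbelow := Finset.sum_eq_zero fun a (ha : a ∈ Finset.range i) =>
    hzero a (by grind) (by grind)
  rcases hi.eq_or_lt with rfl | hi
  · rw [Finset.sum_range_succ, Finset.sum_range_succ, hbelow, hpred, abarWeight,
      form_root_root (by omega) le_rfl (by omega) le_rfl]
    have hx2 := intCast_mul_mem_quarterIntegers hx 2
    push_cast at hx2
    rw [if_neg (by omega), if_neg (by omega), if_pos rfl, if_neg (by omega),
      show 2 * x * 2 = 2 * (2 * x) by ring, qnum_two_mul hp0 hx2, qnum_two_mul hp0 hx]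
    push_cast
    ring_nf
  · rw [← Finset.sum_subset (Finset.range_mono hi), Finset.sum_range_succ, Finset.sum_range_succ,
      Finset.sum_range_succ, hbelow, hpred, abarWeight_mul_qnum_form_self hp0 hx hi,
      abarWeight_mul_qnum_form_succ hp0 hx hi, if_pos hi]
    · push_cast
      ring_nf
    · intro a ha ha'
      simp only [Finset.mem_range] at ha ha'
      exact hzero a ha (by omega)

theorem qsum_eq_div (hp0 : p ≠ 0) (hp : ∀ k : ℕ, 0 < k → p ^ k ≠ 1) {x : ℚ}
    (hx : x ∈ quarterIntegers) (hx0 : x ≠ 0) : qsum p x = qnum p (2 * x) / qnum p x := by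
  rw [qnum_two_mul hp0 hx, mul_div_cancel_left₀ _ (qnum_ne_zero hp0 hp hx hx0)]

theorem qsum_ne_zero (hp0 : p ≠ 0) (hp : ∀ k : ℕ, 0 < k → p ^ k ≠ 1) {x : ℚ}
    (hx : x ∈ quarterIntegers) (hx0 : x ≠ 0) : qsum p x ≠ 0 := by
  have hx2 := intCast_mul_mem_quarterIntegers hx 2
  push_cast at hx2
  rw [qsum_eq_div hp0 hp hx hx0]
  exact div_ne_zero (qnum_ne_zero hp0 hp hx2 (mul_ne_zero two_ne_zero hx0))
    (qnum_ne_zero hp0 hp hx hx0)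

theorem abarCoeff_neg (p : K) (k : ℤ) (a : Fin n) :
    abarCoeff p n (-k) a = -abarCoeff p n k a := by
  simp only [abarCoeff, Int.cast_neg, mul_neg, neg_div, qnum_neg, div_neg, neg_neg, neg_sq, neg_mul]

theorem natCast_div_two_mem_quarterIntegers (k : ℕ) : (k : ℚ) / 2 ∈ quarterIntegers := by
  simpa using intCast_div_two_mem_quarterIntegers k

theorem abarCoeff_pnat (hp0 : p ≠ 0) (hp : ∀ k : ℕ, 0 < k → p ^ k ≠ 1) (k : ℕ+) (a : Fin n) :
    abarCoeff p n (k : ℕ) a =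
      k / qnum p ((k : ℚ) / 2) ^ 2 * abarWeight p n (k / 2) a / qsum p ((n + 1) * (k / 2)) := by
  have hratio (N : ℕ) (hN : N ≠ 0) :
      qnum p (N * (k : ℕ)) / qnum p (N * (k : ℕ) / 2) = qsum p (N * (k / 2)) := by
    have hNk := intCast_mul_mem_quarterIntegers (natCast_div_two_mem_quarterIntegers k) N
    rw [Int.cast_natCast] at hNk
    rw [qsum_eq_div hp0 hp hNk (by positivity), ← mul_div_assoc, mul_div_cancel₀ _ two_ne_zero]
  have hlast := hratio (n + 1) n.succ_ne_zero
  have hcol := hratio (n - a) (by omega)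
  rw [Nat.cast_sub a.2.le] at hcol
  push_cast at hlast
  rw [abarCoeff, abarWeight, Int.cast_natCast, Int.cast_natCast, hcol,
    ← inv_div (qnum p ((n + 1) * (k : ℕ))), hlast, div_eq_mul_inv _ (qsum p _)]

open NExp in
theorem sum_abarCoeff_mul_aPair [CharZero K] (hp0 : p ≠ 0) (hp : ∀ k : ℕ, 0 < k → p ^ k ≠ 1)
    (hn : 2 ≤ n) (k : ℕ+) (j : Fin n) :
    ∑ a, abarCoeff p n (k : ℕ) a * aPair p n k a j = if (j : ℕ) = 0 then -1 else 0 := by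
  have hx := natCast_div_two_mem_quarterIntegers k
  have hnum := qnum_ne_zero hp0 hp hx (by positivity)
  have hsum : qsum p (((n : ℚ) + 1) * (k / 2)) ≠ 0 :=
    qsum_ne_zero hp0 hp (mod_cast intCast_mul_mem_quarterIntegers hx (n + 1)) (by positivity)
  have hterm (a : Fin n) : abarCoeff p n (k : ℕ) a * aPair p n k a j =
      -(abarWeight p n (k / 2) a *
        qnum p (2 * (k / 2) * form (toRat (root n (a + 1))) (toRat (root n (j + 1))))) /
      (qnum p (k / 2) * qsum p ((n + 1) * (k / 2))) := by
    have hk : ((k : ℕ) : K) ≠ 0 := by simp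
    rw [abarCoeff_pnat hp0 hp, aPair, neg_div, qnum_neg, mul_div_cancel₀ _ two_ne_zero]
    field_simp
  simp only [hterm, ← Finset.sum_div, Finset.sum_neg_distrib]
  rw [Fin.sum_univ_eq_sum_range fun a => abarWeight p n (k / 2) a *
    qnum p (2 * (k / 2) * form (toRat (root n (a + 1))) (toRat (root n (j + 1))))]
  obtain ⟨_ | i, hi⟩ := j
  · rw [sum_abarWeight_mul_qnum_form_one hp0 hx hn, if_pos rfl, neg_div,
      div_self (mul_ne_zero hnum hsum)]
  · rw [sum_abarWeight_mul_qnum_form_add_two hp0 hx hi, if_neg i.succ_ne_zero, neg_zero, zero_div]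

open NExp in
theorem aPair_comm (p : K) (k : ℕ+) (i j : Fin n) : aPair p n k i j = aPair p n k j i := by
  rw [aPair, aPair, form_comm]

end Duality

/-! #### Contractions of the factors of the currents -/

namespace NExp

section FactorContractions

variable {n : ℕ} {K : Type*} [Field K] {p : K}

theorem hasContraction_Z_Z [CharZero K] (hp0 : p ≠ 0) (i : Fin n) (s t : ℤ) {y x : ℚ}
    (hy : y ∈ quarterIntegers) (hx : x ∈ quarterIntegers) :
    HasContraction p (Z p n (i + 1) s y) (Z p n (i + 1) t x)
      (-(s * t) • logCoeff (qpow p (x - y))) (s * t) (qpow p (y * (s * t))) where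
  contr_eq := by
    funext k
    have hk : ((k : ℕ) : K) ≠ 0 := by simp
    have hq : qpow p (-(y * (k : ℕ))) * qpow p (x * (k : ℕ)) = qpow p (x - y) ^ (k : ℕ) := by
      rw [← qpow_mul_natCast (sub_mem hx hy), ← qpow_add hp0
        (neg_mem (mul_comm y _ ▸ mod_cast intCast_mul_mem_quarterIntegers hy k))]
      ring_nf
    simp only [contr, Z, Nat.add_right_cancel_iff, Fin.val_inj, mul_zero, zero_mul,
      Finset.sum_const_zero, zero_add, ite_mul, mul_ite, Finset.sum_ite_eq',
      Finset.mem_univ, if_true, logCoeff, Pi.smul_apply, zsmul_eq_mul, ← hq]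
    push_cast
    field_simp
  pow_shift w := by
    simp [Z, Charge.shift_be, form_add, form_toRat_smul, form_eps, Nat.succ_le_of_lt i.2,
      -zsmul_eq_mul]
    ring
  scal_shift w := by
    have hyst := intCast_mul_mem_quarterIntegers hy (s * t)
    rw [mul_comm] at hyst
    push_cast at hyst
    simp [Z, Charge.shift_be, form_add, form_toRat_smul, form_eps, Nat.succ_le_of_lt i.2,
      -zsmul_eq_mul, ← qpow_add hp0 hyst]
    ring_nf

theorem hasContraction_Z_Z_of_ne (p : K) {i j : ℕ} (hij : i ≠ j) (s t : ℤ) (y x : ℚ) :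
    HasContraction p (Z p n i s y) (Z p n j t x) 0 0 1 where
  contr_eq := by
    have hzero (k : ℕ+) (a : Fin n) : (Z p n i s y).annB k a * (Z p n j t x).creB k a = 0 := by
      simp only [Z]
      grind
    funext k
    simp only [contr, hzero]
    simp [Z]
  pow_shift w := by
    simp [Z, Charge.shift_be, form_add, form_toRat_smul, form_eps, hij, -zsmul_eq_mul]
  scal_shift w := by
    simp [Z, Charge.shift_be, form_add, form_toRat_smul, form_eps, hij, -zsmul_eq_mul]

theorem uncoupled_Z_Z (p : K) {i j : ℕ} (hij : i ≠ j) (s t : ℤ) (y x : ℚ) :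
    Uncoupled p (Z p n i s y) (Z p n j t x) :=
  ⟨hasContraction_Z_Z_of_ne p hij s t y x, hasContraction_Z_Z_of_ne p hij.symm t s x y⟩

theorem uncoupled_phiA_Z (p : K) (μ : Fin n → ℚ) (i : ℕ) (s : ℤ) (y : ℚ) :
    Uncoupled p (phiA p n μ) (Z p n i s y) := by
  constructor <;> constructor
  case left.contr_eq | right.contr_eq => funext k; simp [contr, phiA, Z]
  all_goals simp [phiA, Z, Charge.shift_al, Charge.shift_be, form_add, form_toRat_zero]

theorem uncoupled_Y_Z (p : K) (i j : ℕ) (s t : ℤ) (y : ℚ) :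
    Uncoupled p (Y p n i s) (Z p n j t y) := by
  constructor <;> constructor
  case left.contr_eq | right.contr_eq => funext k; simp [contr, Y, Z]
  all_goals simp [Y, Z, Charge.shift_al, Charge.shift_be, form_add, form_toRat_zero]

theorem contr_Y_right (p : K) (V : NExp n K) (j : Fin n) (s : ℤ) (k : ℕ+) :
    contr p V (Y p n (j + 1) s) k =
      s * (qpow p ((s : ℚ) * (k : ℕ) / 4) / qnum p (-((k : ℕ) : ℚ) / 2)) *
        ∑ a, V.annA k a * aPair p n k a j := by
  simp only [contr, Y, Nat.add_right_cancel_iff, Fin.val_inj, mul_ite, ite_mul, mul_zero, zero_mul,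
    Finset.sum_ite_eq', Finset.mem_univ, if_true, Finset.sum_const_zero, add_zero, Finset.mul_sum]
  exact Finset.sum_congr rfl fun a _ => by ring

theorem contr_Y_left (p : K) (W : NExp n K) (j : Fin n) (s : ℤ) (k : ℕ+) :
    contr p (Y p n (j + 1) s) W k =
      -s * (qpow p ((s : ℚ) * (k : ℕ) / 4) / qnum p (-((k : ℕ) : ℚ) / 2)) *
        ∑ a, W.creA k a * aPair p n k a j := by
  simp only [contr, Y, zero_mul, Finset.sum_const_zero, add_zero, Finset.mul_sum]
  rw [Finset.sum_eq_single j (fun i _ hij => by simp [Fin.val_inj, hij]) (by simp)]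
  simp only [if_true, aPair_comm p k j]
  exact Finset.sum_congr rfl fun a _ => by ring

theorem form_fundWt_one_root_add_one (hn : 2 ≤ n) (i : ℕ) :
    form (toRat (fundWt n 1)) (toRat (root n (i + 1))) = if i = 0 then 1 / 2 else 0 := by
  simp only [fundWt_one, form_eps_one_root hn i.succ_pos, Nat.succ_eq_add_one, Nat.add_eq_right]

theorem hasContraction_phiA_Y [CharZero K] (hp0 : p ≠ 0) (hp : ∀ k : ℕ, 0 < k → p ^ k ≠ 1)
    (hn : 2 ≤ n) (μ : Fin n → ℚ) (i : Fin n) (s : ℤ) :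
    HasContraction p (phiA p n μ) (Y p n (i + 1) s)
      (if (i : ℕ) = 0 then s • logCoeff (qpow p (-(n + 3 / 4) + s / 4)) else 0)
      (if (i : ℕ) = 0 then -s else 0) (if (i : ℕ) = 0 then qpow p ((n + 1 / 2) * -s) else 1) where
  contr_eq := by
    funext k
    have hk : ((k : ℕ) : K) ≠ 0 := by simp
    have hnum := qnum_ne_zero hp0 hp (natCast_div_two_mem_quarterIntegers k) (by positivity)
    have hq : qpow p (-(((n : ℚ) + 3 / 4) * (k : ℕ))) * qpow p ((s : ℚ) * (k : ℕ) / 4) =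
        qpow p (-(n + 3 / 4) + s / 4) ^ (k : ℕ) := by
      rw [← qpow_mul_natCast (mem_quarterIntegers.2 ⟨-(4 * n + 3) + s, by push_cast; ring⟩),
        ← qpow_add hp0 (mem_quarterIntegers.2 ⟨-((4 * n + 3) * (k : ℕ)), by push_cast; ring⟩)]
      ring_nf
    simp only [contr_Y_right, phiA, mul_assoc, ← Finset.mul_sum, sum_abarCoeff_mul_aPair hp0 hp hn]
    split_ifs
    · simp only [neg_div, qnum_neg, logCoeff, Pi.smul_apply, zsmul_eq_mul, ← hq]
      field_simp
    · simp
  pow_shift w := by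
    simp only [phiA, Y, Charge.shift_al, form_add, form_toRat_smul, form_fundWt_one_root_add_one hn]
    split_ifs <;> ring
  scal_shift w := by
    simp only [phiA, Y, Charge.shift_al, form_add, form_toRat_smul, form_fundWt_one_root_add_one hn]
    split_ifs
    · rw [← qpow_add hp0 (mem_quarterIntegers.2 ⟨(4 * n + 2) * -s, by push_cast; ring⟩)]
      ring_nf
    · simp

theorem hasContraction_Y_phiA [CharZero K] (hp0 : p ≠ 0) (hp : ∀ k : ℕ, 0 < k → p ^ k ≠ 1)
    (hn : 2 ≤ n) (μ : Fin n → ℚ) (i : Fin n) (s : ℤ) :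
    HasContraction p (Y p n (i + 1) s) (phiA p n μ)
      (if (i : ℕ) = 0 then s • logCoeff (qpow p (n + 1 / 4 + s / 4)) else 0)
      (if (i : ℕ) = 0 then -s else 0) 1 where
  contr_eq := by
    funext k
    have hk : ((k : ℕ) : K) ≠ 0 := by simp
    have hnum := qnum_ne_zero hp0 hp (natCast_div_two_mem_quarterIntegers k) (by positivity)
    have hq : qpow p (((n : ℚ) + 1 / 4) * (k : ℕ)) * qpow p ((s : ℚ) * (k : ℕ) / 4) =
        qpow p (n + 1 / 4 + s / 4) ^ (k : ℕ) := by
      rw [← qpow_mul_natCast (mem_quarterIntegers.2 ⟨4 * n + 1 + s, by push_cast; ring⟩),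
        ← qpow_add hp0 (mem_quarterIntegers.2 ⟨(4 * n + 1) * (k : ℕ), by push_cast; ring⟩)]
      ring_nf
    simp only [contr_Y_left, phiA, abarCoeff_neg, mul_neg, neg_mul, Finset.sum_neg_distrib,
      mul_assoc, ← Finset.mul_sum, sum_abarCoeff_mul_aPair hp0 hp hn]
    split_ifs
    · simp only [neg_div, qnum_neg, logCoeff, Pi.smul_apply, zsmul_eq_mul, ← hq]
      field_simp
    · simp
  pow_shift w := by
    simp only [Y, phiA, Charge.shift_al, form_add]
    rw [form_comm _ (toRat (fundWt n 1)), form_fundWt_one_root_add_one hn]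
    split_ifs <;> ring
  scal_shift w := by simp [Y]

theorem uncoupled_phiA_Y [CharZero K] (hp0 : p ≠ 0) (hp : ∀ k : ℕ, 0 < k → p ^ k ≠ 1)
    (hn : 2 ≤ n) (μ : Fin n → ℚ) {i : Fin n} (hi : (i : ℕ) ≠ 0) (s : ℤ) :
    Uncoupled p (phiA p n μ) (Y p n (i + 1) s) where
  left := by simpa only [hi, if_false] using hasContraction_phiA_Y hp0 hp hn μ i s
  right := by simpa only [hi, if_false] using hasContraction_Y_phiA hp0 hp hn μ i s

end FactorContractions

end NExp

section QuantumBrackets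

variable {K R M N : Type*} [Field K] [Ring R] [Algebra K R] [AddCommGroup M] [Module K M]
  [AddCommGroup N] [Module K N]

/-- The `v`-commutator `[a, b]_v = a b - v b a`, as a bilinear map. -/
def qbracket (v : K) : R →ₗ[K] R →ₗ[K] R :=
  LinearMap.mul K R - v • (LinearMap.mul K R).flip

theorem qbracket_apply (v : K) (a b : R) : qbracket v a b = a * b - v • (b * a) := rfl

theorem qbracket_one_eq_zero_iff {a b : R} : qbracket (1 : K) a b = 0 ↔ Commute a b := by
  rw [qbracket_apply, one_smul, sub_eq_zero, commute_iff_eq]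

theorem map_smul_sub_congr {f g : M →ₗ[K] N} {a b a' b' : M} (ha : f a = g a') (hb : f b = g b')
    (x : K) : f (x • (a - b)) = g (x • (a' - b')) := by
  simp only [map_smul, map_sub, ha, hb]

theorem qbracket_smul_sub_smul_sub_eq_zero {v : K} {a b a' b' : R} (ha : qbracket v a a' = 0)
    (hb : qbracket v b b' = 0) (hab : qbracket v a b' = -qbracket v b a') (x y : K) :
    qbracket v (x • (a - b)) (y • (a' - b')) = 0 := by
  simp [ha, hb, hab]

end QuantumBrackets

section QuantumCommutators

variable {n : ℕ} {K : Type*} [Field K] {p : K}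

theorem qcomm_eq_qbracket (v : K) (A B : Series n K) :
    qcomm v A B = fun r s => qbracket v (A r) (B s) := rfl

theorem qcomm_one_eq_zero_iff {A B : Series n K} :
    qcomm 1 A B = 0 ↔ ∀ r s, Commute (A r) (B s) := by
  simp only [qcomm_eq_qbracket, funext_iff, Pi.zero_apply]
  exact forall₂_congr fun r s => qbracket_one_eq_zero_iff

theorem commute_smul_series {S : Module.End K (Fock n K)} {X : Series n K}
    (h : ∀ s, Commute S (X s)) (a : K) (s : ℚ) : Commute S ((a • X) s) :=
  Commute.smul_right (h s) a

theorem commute_sub_series {S : Module.End K (Fock n K)} {X X' : Series n K}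
    (h : ∀ s, Commute S (X s)) (h' : ∀ s, Commute S (X' s)) (s : ℚ) : Commute S ((X - X') s) :=
  Commute.sub_right (R := Module.End K (Fock n K)) (h s) (h' s)

theorem commute_qdiff_right {S : Module.End K (Fock n K)} {G : ℚ → Series n K}
    (h : ∀ x s, Commute S (G x s)) (y s : ℚ) : Commute S (qdiff p G y s) :=
  Commute.smul_right (Commute.sub_right (R := Module.End K (Fock n K)) (h _ _) (h _ _)) _

theorem commute_qdiff_left {S : Module.End K (Fock n K)} {G : ℚ → Series n K}
    (h : ∀ x r, Commute (G x r) S) (y r : ℚ) : Commute (qdiff p G y r) S :=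
  (commute_qdiff_right (fun x r => (h x r).symm) y r).symm

theorem qcomm_smul_left (v a : K) (A B : Series n K) : qcomm v (a • A) B = a • qcomm v A B := by
  funext r s
  exact LinearMap.map_smul₂ (qbracket v) a (A r) (B s)

theorem qcomm_qdiff_qdiff_eq_zero {v : K} {G H : ℚ → Series n K} {y : ℚ}
    (hdiag : ∀ x, x = y + 1 / 2 ∨ x = y - 1 / 2 → qcomm v (G x) (H x) = 0)
    (hanti : qcomm v (G (y + 1 / 2)) (H (y - 1 / 2)) =
      -qcomm v (G (y - 1 / 2)) (H (y + 1 / 2))) :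
    qcomm v (qdiff p G y) (qdiff p H y) = 0 := by
  funext r s
  exact qbracket_smul_sub_smul_sub_eq_zero (R := Module.End K (Fock n K))
    (congrFun₂ (hdiag _ (.inl rfl)) (r + 1) (s + 1))
    (congrFun₂ (hdiag _ (.inr rfl)) (r + 1) (s + 1))
    (congrFun₂ hanti (r + 1) (s + 1)) _ _

theorem qcomm_qdiff_right_eq_smul_mulZdivW {v v' x : K} {A : Series n K} {G : ℚ → Series n K}
    {y : ℚ} (h : ∀ z, qcomm v A (G z) = x • mulZdivW (qcomm v' A (G z))) :
    qcomm v A (qdiff p G y) = x • mulZdivW (qcomm v' A (qdiff p G y)) := by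
  simp only [funext_iff] at h ⊢
  exact fun r s => map_smul_sub_congr (M := Module.End K (Fock n K))
    (N := Module.End K (Fock n K)) (f := qbracket v (A r)) (g := x • qbracket v' (A (r - 1)))
    (h _ _ _) (h _ _ _) _

theorem qcomm_qdiff_left_eq_smul_mulZdivW {v v' x : K} {G : ℚ → Series n K} {B : Series n K}
    {y : ℚ} (h : ∀ z, z = y + 1 / 2 ∨ z = y - 1 / 2 →
      qcomm v (G z) B = x • mulZdivW (qcomm v' (G z) B)) :
    qcomm v (qdiff p G y) B = x • mulZdivW (qcomm v' (qdiff p G y) B) := by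
  funext r s
  refine map_smul_sub_congr (M := Module.End K (Fock n K)) (N := Module.End K (Fock n K))
    (f := (qbracket v).flip (B s)) (g := x • (qbracket v').flip (B (s + 1))) ?_ ?_ _
  · rw [sub_add_eq_add_sub]
    exact congrFun₂ (h _ (.inl rfl)) (r + 1) s
  · rw [sub_add_eq_add_sub]
    exact congrFun₂ (h _ (.inr rfl)) (r + 1) s

end QuantumCommutators

namespace NExp

section CommutatorFactors

variable {K : Type*} [Field K] [CharZero K]

theorem commFactor_geometric {a b α β : K} (hα : α ≠ 0) (hβ : β ≠ 0) (h : a * β = b * α) (m : ℤ) :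
    commFactor 1 (logCoeff β - logCoeff α) (logCoeff β⁻¹ - logCoeff α⁻¹) b a m =
      (b - a) * β ^ m := by
  have hβ' : β⁻¹ ^ (-m - 1) = β ^ m * β := by
    rw [inv_zpow', neg_sub, sub_neg_eq_add, add_comm, zpow_add_one₀ hβ]
  rw [commFactor, expZ_logCoeff_sub, expZ_logCoeff_sub, hβ', zpow_sub_one₀ hβ]
  rcases lt_trichotomy m 0 with hm | rfl | hm
  · simp only [hm, if_true, show ¬-m < 0 by omega, show -m ≠ 0 by omega, if_false]
    field_simp
    grind
  · simp
  · simp only [show ¬m < 0 by omega, hm.ne', if_false, show -m < 0 by omega, if_true]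
    field_simp
    grind

theorem commFactor_zero_left {a b κ v' : K} (h : κ * b = a * v') (m : ℤ) :
    commFactor κ 0 (logCoeff b - logCoeff a) κ 1 m =
      a * commFactor v' 0 (logCoeff b - logCoeff a) κ 1 (m + 1) := by
  have key := expZ_logCoeff_sub_add_one a b (-m - 1)
  rw [sub_add_cancel, ← neg_add'] at key
  simp only [commFactor, expZ_zero, show -(m + 1) = -1 ↔ m = 0 by omega,
    show -(m + 1) = 0 ↔ m + 1 = 0 by omega] at key ⊢
  split_ifs at key ⊢ <;>
    first
    | omega
    | linear_combination (-κ) * key - h * expZ K (logCoeff b - logCoeff a) (-(m + 1))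

theorem commFactor_zero_right {a b κ v x : K} (hb : x * b = 1) (hv : v = x * κ * a) (m : ℤ) :
    commFactor v (logCoeff b - logCoeff a) 0 κ 1 m =
      x * commFactor κ (logCoeff b - logCoeff a) 0 κ 1 (m + 1) := by
  have key := expZ_logCoeff_sub_add_one a b m
  simp only [commFactor, expZ_zero, neg_eq_zero, eq_neg_iff_add_eq_zero, hv] at key ⊢
  split_ifs at key ⊢ <;>
    linear_combination (-x * κ) * key + (-κ * expZ K (logCoeff b - logCoeff a) m) * hb

end CommutatorFactors

end NExp

namespace NExp

section VertexOperator

variable {n : ℕ} {K : Type*} [Field K] {p : K}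

/-- The factor `φ(z) Z_1^+(q^{n + 1/2 + y} z)` of the vertex operator. -/
def phiZ (p : K) (n : ℕ) (μ : Fin n → ℚ) (y : ℚ) : NExp n K :=
  phiA p n μ * Z p n 1 1 (n + 1 / 2 + y)

/-- The normally ordered exponential whose `q`-difference in `x` is `X_1^+(z)`. -/
def plusTerm (p : K) (n : ℕ) (x : ℚ) : NExp n K := Z p n 1 1 x * Z p n 2 (-1) 0 * Y p n 1 1

/-- The normally ordered exponential whose `q`-difference in `x` is `X_1^-(z)`. -/
def minusTerm (p : K) (n : ℕ) (x : ℚ) : NExp n K := Z p n 1 (-1) 0 * Z p n 2 1 x * Y p n 1 (-1)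

theorem exists_pow_Z_eq_intCast (p : K) (i : ℕ) (s : ℤ) (y : ℚ) (w : Charge n) :
    ∃ m : ℤ, (Z p n i s y).pow w = m := by
  refine ⟨s * ∑ k, eps n i k * w.2.2 k, ?_⟩
  simp only [Z, form, Charge.be, toRat, Finset.mul_sum]
  push_cast
  exact Finset.sum_congr rfl fun k _ => by ring

theorem dilate_Z (hp0 : p ≠ 0) {ℓ : ℚ} (hℓ : ℓ ∈ quarterIntegers) (i : ℕ) (s : ℤ) (y : ℚ) :
    (Z p n i s y).dilate p ℓ = Z p n i s (ℓ + y) := by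
  ext1
  case scal =>
    funext w
    obtain ⟨m, hm⟩ := exists_pow_Z_eq_intCast p i s y w
    have hm' : (s : ℚ) * (2 * form (toRat (eps n i)) w.be) = m := hm
    simp only [dilate, Z, hm', add_mul,
      qpow_add hp0 (mul_comm ℓ (m : ℚ) ▸ intCast_mul_mem_quarterIntegers hℓ m)]
  case creB =>
    funext k j
    have h := qpow_add hp0 (mul_comm ℓ _ ▸ mod_cast intCast_mul_mem_quarterIntegers hℓ k :
      ℓ * (k : ℕ) ∈ quarterIntegers) (y * (k : ℕ))
    simp only [dilate, Z, add_mul, h]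
    split_ifs <;> ring
  case annB =>
    funext k j
    have h := qpow_add hp0 (neg_mem (mul_comm ℓ _ ▸ mod_cast intCast_mul_mem_quarterIntegers hℓ k) :
      -(ℓ * (k : ℕ)) ∈ quarterIntegers) (-(y * (k : ℕ)))
    simp only [dilate, Z, add_mul, neg_add, h]
    split_ifs <;> ring
  all_goals simp [dilate, Z, Pi.zero_def]

theorem phiZ_mul_dilate_plusTerm (hp0 : p ≠ 0) (μ : Fin n → ℚ) (y x : ℚ) :
    phiZ p n μ y * (plusTerm p n x).dilate p (n + 1 / 2) =
      phiZ p n μ x * (plusTerm p n y).dilate p (n + 1 / 2) := by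
  have hℓ := natCast_add_half_mem_quarterIntegers n
  have hpow (x : ℚ) (w : Charge n) : (n + 1 / 2 : ℚ) * (Z p n 1 1 x).pow w ∈ quarterIntegers := by
    obtain ⟨m, hm⟩ := exists_pow_Z_eq_intCast p 1 1 x w
    exact hm ▸ mul_comm (m : ℚ) _ ▸ intCast_mul_mem_quarterIntegers hℓ m
  simp only [phiZ, plusTerm, mul_assoc, dilate_mul hp0 (hpow _), dilate_Z hp0 hℓ]
  rw [mul_left_comm (Z p n 1 1 _)]

section Contractions

variable [CharZero K] (hp0 : p ≠ 0) (hp : ∀ k : ℕ, 0 < k → p ^ k ≠ 1) (hn : 2 ≤ n)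
  (μ : Fin n → ℚ)

include hp0 hp hn

theorem uncoupled_phiZ_Z_mul_Z_mul_Y {i : Fin n} (hi : (i : ℕ) ≠ 0) {j l : ℕ} (hj : 1 ≠ j)
    (hl : 1 ≠ l) (s t t' : ℤ) (y x x' : ℚ) :
    Uncoupled p (phiZ p n μ y) (Z p n j t x * Z p n l t' x' * Y p n (i + 1) s) :=
  .mul_left
    (.mul_right (.mul_right (uncoupled_phiA_Z p μ j t x) (uncoupled_phiA_Z p μ l t' x'))
      (uncoupled_phiA_Y hp0 hp hn μ hi s))
    (.mul_right (.mul_right (uncoupled_Z_Z p hj 1 t _ x) (uncoupled_Z_Z p hl 1 t' _ x'))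
      (uncoupled_Y_Z p _ 1 s 1 _).symm)

theorem hasContraction_phiZ_plusTerm {y x : ℚ} (hy : y ∈ quarterIntegers)
    (hx : x ∈ quarterIntegers) :
    HasContraction p (phiZ p n μ y) (plusTerm p n x)
      (logCoeff (qpow p (-(n + 1 / 2))) - logCoeff (qpow p (x - (n + 1 / 2 + y)))) 0
      (qpow p y) := by
  have hℓ := natCast_add_half_mem_quarterIntegers n
  have hφ := ((uncoupled_phiA_Z p μ 1 1 x).mul_right
    (uncoupled_phiA_Z p μ 2 (-1) 0)).left.mul_right
      (hasContraction_phiA_Y hp0 hp hn μ (⟨0, by omega⟩ : Fin n) 1)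
  have hZ := ((hasContraction_Z_Z hp0 (⟨0, by omega⟩ : Fin n) 1 1 (add_mem hℓ hy) hx).mul_right
    (uncoupled_Z_Z p (OfNat.one_ne_ofNat 2) 1 (-1) (n + 1 / 2 + y) 0).left).mul_right
      (uncoupled_Y_Z p 1 1 1 1 _).right
  have hφZ : HasContraction p (phiZ p n μ y) (plusTerm p n x) _ _ _ := hφ.mul_left hZ
  convert hφZ using 1
  · norm_num [sub_eq_add_neg]
    ring_nf
  · norm_num
  · norm_num [-neg_add_rev]
    rw [← qpow_add hp0 (neg_mem hℓ)]
    ring_nf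

theorem hasContraction_plusTerm_phiZ {y x : ℚ} (hy : y ∈ quarterIntegers)
    (hx : x ∈ quarterIntegers) :
    HasContraction p (plusTerm p n x) (phiZ p n μ y)
      (logCoeff (qpow p (n + 1 / 2)) - logCoeff (qpow p (n + 1 / 2 + y - x))) 0
      (qpow p x) := by
  have hℓ := natCast_add_half_mem_quarterIntegers n
  have hφ := ((uncoupled_phiA_Z p μ 1 1 x).mul_right
    (uncoupled_phiA_Z p μ 2 (-1) 0)).right.mul_left
      (hasContraction_Y_phiA hp0 hp hn μ (⟨0, by omega⟩ : Fin n) 1)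
  have hZ := ((hasContraction_Z_Z hp0 (⟨0, by omega⟩ : Fin n) 1 1 hx (add_mem hℓ hy)).mul_left
    (uncoupled_Z_Z p (OfNat.one_ne_ofNat 2) 1 (-1) (n + 1 / 2 + y) 0).right).mul_left
      (uncoupled_Y_Z p 1 1 1 1 _).left
  have hφZ : HasContraction p (plusTerm p n x) (phiZ p n μ y) _ _ _ := hφ.mul_right hZ
  convert hφZ using 1
  · norm_num [sub_eq_add_neg]
    ring_nf
  · norm_num
  · norm_num

theorem hasContraction_phiZ_minusTerm {y : ℚ} (hy : y ∈ quarterIntegers) (x : ℚ) :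
    HasContraction p (phiZ p n μ y) (minusTerm p n x)
      (logCoeff (qpow p (-(n + 1 / 2 + y))) - logCoeff (qpow p (-(n + 1)))) 0
      (qpow p (-y)) := by
  have hℓ := natCast_add_half_mem_quarterIntegers n
  have hφ := ((uncoupled_phiA_Z p μ 1 (-1) 0).mul_right
    (uncoupled_phiA_Z p μ 2 1 x)).left.mul_right
      (hasContraction_phiA_Y hp0 hp hn μ (⟨0, by omega⟩ : Fin n) (-1))
  have hZ := ((hasContraction_Z_Z hp0 (⟨0, by omega⟩ : Fin n) 1 (-1) (add_mem hℓ hy)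
    (zero_mem _)).mul_right (uncoupled_Z_Z p (OfNat.one_ne_ofNat 2) 1 1 (n + 1 / 2 + y)
      x).left).mul_right (uncoupled_Y_Z p 1 1 (-1) 1 _).right
  have hφZ : HasContraction p (phiZ p n μ y) (minusTerm p n x) _ _ _ := hφ.mul_left hZ
  convert hφZ using 1
  · norm_num [sub_eq_add_neg]
    ring_nf
  · norm_num
  · norm_num
    rw [← qpow_add hp0 hℓ]
    ring_nf

theorem hasContraction_minusTerm_phiZ {y : ℚ} (hy : y ∈ quarterIntegers) (x : ℚ) :
    HasContraction p (minusTerm p n x) (phiZ p n μ y)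
      (logCoeff (qpow p (n + 1 / 2 + y)) - logCoeff (qpow p n)) 0 1 := by
  have hℓ := natCast_add_half_mem_quarterIntegers n
  have hφ := ((uncoupled_phiA_Z p μ 1 (-1) 0).mul_right
    (uncoupled_phiA_Z p μ 2 1 x)).right.mul_left
      (hasContraction_Y_phiA hp0 hp hn μ (⟨0, by omega⟩ : Fin n) (-1))
  have hZ := ((hasContraction_Z_Z hp0 (⟨0, by omega⟩ : Fin n) (-1) 1 (zero_mem _)
    (add_mem hℓ hy)).mul_left (uncoupled_Z_Z p (OfNat.one_ne_ofNat 2) 1 1 (n + 1 / 2 + y)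
      x).right).mul_left (uncoupled_Y_Z p 1 1 (-1) 1 _).left
  have hφZ : HasContraction p (minusTerm p n x) (phiZ p n μ y) _ _ _ := hφ.mul_right hZ
  convert hφZ using 1
  · norm_num [sub_eq_add_neg]
    ring_nf
  · norm_num
  · norm_num [qpow_zero]

theorem qcomm_phiZ_plusTerm {y x : ℚ} (hy : y ∈ quarterIntegers) (hx : x ∈ quarterIntegers)
    (r s : ℚ) :
    qcomm 1 ((phiZ p n μ y).series p) ((plusTerm p n x).series p) r s =
      (qpow p y - qpow p x) • normalSeries p (phiZ p n μ y) (plusTerm p n x) r s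
        fun m => (qpow p (n + 1 / 2))⁻¹ ^ m := by
  have hℓ := natCast_add_half_mem_quarterIntegers n
  have hℓyx := sub_mem (add_mem hℓ hy) hx
  rw [qcomm_eq_normalSeries (hasContraction_phiZ_plusTerm hp0 hp hn μ hy hx)
    (hasContraction_plusTerm_phiZ hp0 hp hn μ hy hx), ← map_smul]
  refine congrArg _ (funext fun m => ?_)
  rw [← neg_sub (_ + _) x, qpow_neg hℓ, qpow_neg hℓyx]
  have h := commFactor_geometric (inv_ne_zero (qpow_ne_zero hp0 (n + 1 / 2 + y - x)))
    (inv_ne_zero (qpow_ne_zero hp0 (n + 1 / 2))) (a := qpow p x) (b := qpow p y) ?_ m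
  · rwa [inv_inv, inv_inv] at h
  · rw [qpow_sub hp0 _ hx, qpow_add hp0 hℓ]
    field_simp [qpow_ne_zero hp0]

theorem qcomm_phiZ_plusTerm_self {x : ℚ} (hx : x ∈ quarterIntegers) :
    qcomm 1 ((phiZ p n μ x).series p) ((plusTerm p n x).series p) = 0 := by
  funext r s
  rw [qcomm_phiZ_plusTerm hp0 hp hn μ hx hx, sub_self, zero_smul]
  rfl

theorem qcomm_phiZ_plusTerm_antisymm {y x : ℚ} (hy : y ∈ quarterIntegers)
    (hx : x ∈ quarterIntegers) :
    qcomm 1 ((phiZ p n μ y).series p) ((plusTerm p n x).series p) =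
      -qcomm 1 ((phiZ p n μ x).series p) ((plusTerm p n y).series p) := by
  funext r s
  rw [Pi.neg_apply, Pi.neg_apply, qcomm_phiZ_plusTerm hp0 hp hn μ hy hx,
    qcomm_phiZ_plusTerm hp0 hp hn μ hx hy, ← neg_sub (qpow p x),
    normalSeries_delta_congr (V := phiZ p n μ y) (V' := phiZ p n μ x) hp0
      (natCast_add_half_mem_quarterIntegers n) rfl (phiZ_mul_dilate_plusTerm hp0 μ y x)]
  exact neg_smul (M := Module.End K (Fock n K)) _ _

theorem qcomm_phiZ_minusTerm {y : ℚ} (hy : y = 1 / 2 ∨ y = -(1 / 2)) (x : ℚ) :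
    qcomm (qpow p (-1 / 2)) ((phiZ p n μ y).series p) ((minusTerm p n x).series p) =
      qpow p n • mulZdivW
        (qcomm (qpow p (1 / 2)) ((phiZ p n μ y).series p) ((minusTerm p n x).series p)) := by
  have hnat : (n : ℚ) ∈ quarterIntegers := mod_cast intCast_mem_quarterIntegers n
  have hhalf := half_mem_quarterIntegers
  have hmem : y ∈ quarterIntegers := by
    rcases hy with rfl | rfl
    exacts [hhalf, neg_mem hhalf]
  refine qcomm_eq_smul_mulZdivW (hasContraction_phiZ_minusTerm hp0 hp hn μ hmem x)
    (hasContraction_minusTerm_phiZ hp0 hp hn μ hmem x) fun m => ?_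
  rcases hy with rfl | rfl
  · rw [add_assoc, add_halves, sub_self, neg_div]
    exact commFactor_zero_left (by
      rw [← qpow_add hp0 (neg_mem hhalf), ← qpow_add hp0 hnat]; ring_nf) m
  · rw [add_neg_cancel_right, sub_self, neg_neg]
    exact commFactor_zero_right (by rw [← qpow_add hp0 hnat, add_neg_cancel, qpow_zero]) (by
      rw [← qpow_add hp0 hnat, ← qpow_add hp0 (add_mem hnat hhalf)]; ring_nf) m

end Contractions

end VertexOperator

end NExp

section Relations

open NExp

variable {n : ℕ} {K : Type*} [Field K] {p : K}

/-- The vertex operator `Φ_{\bar 1}(z)` with an arbitrary rational weight `μ` in place of the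
classical part of a highest weight. The weight `μ` enters through a power of `z` and a constant
factor only. -/
def vertexOp (p : K) (n : ℕ) (μ : Fin n → ℚ) (c : K) : Series n K :=
  c • qdiff p (fun y => (phiZ p n μ y).series p) 0

theorem qcomm_one_vertexOp_eq_zero {μ : Fin n → ℚ} {X : Series n K}
    (h : ∀ y r s, Commute ((phiZ p n μ y).series p r) (X s)) (c : K) :
    qcomm 1 (vertexOp p n μ c) X = 0 :=
  qcomm_one_eq_zero_iff.2 fun r s =>
    Commute.smul_left (commute_qdiff_left (fun y r => h y r s) 0 r) c

variable [CharZero K] (hp0 : p ≠ 0) (hp : ∀ k : ℕ, 0 < k → p ^ k ≠ 1) (hn : 2 ≤ n)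
  (μ : Fin n → ℚ) (c : K)

include hp0 hp hn

theorem qcomm_vertexOp_Xplus_one : qcomm 1 (vertexOp p n μ c) (Xplus p n 1) = 0 := by
  have hmem {x : ℚ} (hx : x = 0 + 1 / 2 ∨ x = 0 - 1 / 2) : x ∈ quarterIntegers := by
    rcases hx with rfl | rfl
    exacts [add_mem (zero_mem _) half_mem_quarterIntegers,
      sub_mem (zero_mem _) half_mem_quarterIntegers]
  rw [Xplus, if_pos (by omega), vertexOp, qcomm_smul_left]
  exact smul_eq_zero_of_right c <| qcomm_qdiff_qdiff_eq_zero
    (fun _ hx => qcomm_phiZ_plusTerm_self hp0 hp hn μ (hmem hx))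
    (qcomm_phiZ_plusTerm_antisymm hp0 hp hn μ (hmem (.inl rfl)) (hmem (.inr rfl)))

theorem qcomm_vertexOp_Xplus {i : ℕ} (hi : 2 ≤ i) (hin : i ≤ n) :
    qcomm 1 (vertexOp p n μ c) (Xplus p n i) = 0 := by
  obtain ⟨j, rfl⟩ : ∃ j, i = j + 1 := ⟨i - 1, by omega⟩
  have h {l : ℕ} (hl : 1 ≠ l) (t : ℤ) (x x' y : ℚ) :=
    (uncoupled_phiZ_Z_mul_Z_mul_Y hp0 hp hn μ (i := ⟨j, hin⟩) (by grind)
      (show 1 ≠ j + 1 by omega) hl 1 1 t y x x').commute_series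
  refine qcomm_one_vertexOp_eq_zero (fun y r s => ?_) c
  unfold Xplus
  split_ifs with hlt
  · exact commute_qdiff_right (fun x => h (by omega) (-1) x 0 y r) 0 s
  · obtain rfl : j + 1 = n := by omega
    exact commute_sub_series
      (commute_smul_series
        (commute_qdiff_right (commute_qdiff_right fun x => h (by omega) 1 0 x y r) 0) _)
      (commute_qdiff_right (fun x' => commute_qdiff_right (fun x => h (by omega) 1 x' x y r) _) _)
      s

theorem qcomm_vertexOp_Xminus {i : ℕ} (hi : 2 ≤ i) (hin : i ≤ n) :
    qcomm 1 (vertexOp p n μ c) (Xminus p n i) = 0 := by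
  obtain ⟨j, rfl⟩ : ∃ j, i = j + 1 := ⟨i - 1, by omega⟩
  have h {l : ℕ} (hl : 1 ≠ l) (t : ℤ) (x x' y : ℚ) :=
    (uncoupled_phiZ_Z_mul_Z_mul_Y hp0 hp hn μ (i := ⟨j, hin⟩) (by grind)
      (show 1 ≠ j + 1 by omega) hl (-1) (-1) t y x x').commute_series
  refine qcomm_one_vertexOp_eq_zero (fun y r s => ?_) c
  unfold Xminus
  split_ifs with hlt
  · exact commute_qdiff_right (fun x => h (by omega) 1 0 x y r) 0 s
  · obtain rfl : j + 1 = n := by omega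
    exact commute_smul_series (h (by omega) (-1) (1 / 2) (-1 / 2) y r) _ s

theorem qcomm_vertexOp_Xminus_one :
    qcomm (qpow p (-1 / 2)) (vertexOp p n μ c) (Xminus p n 1) =
      qpow p n • mulZdivW (qcomm (qpow p (1 / 2)) (vertexOp p n μ c) (Xminus p n 1)) := by
  have hhalf {y : ℚ} (hy : y = 0 + 1 / 2 ∨ y = 0 - 1 / 2) : y = 1 / 2 ∨ y = -(1 / 2) := by
    rwa [zero_add, zero_sub] at hy
  have h := qcomm_qdiff_left_eq_smul_mulZdivW (p := p) fun y hy =>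
    qcomm_qdiff_right_eq_smul_mulZdivW (p := p) (y := 0) fun x =>
      qcomm_phiZ_minusTerm hp0 hp hn μ (hhalf hy) x
  rw [Xminus, if_pos (by omega), vertexOp, qcomm_smul_left, qcomm_smul_left]
  exact (congrArg (c • ·) h).trans (smul_comm c (qpow p (n : ℚ)) _)

end Relations

end

end SpVertex

theorem mainTheorem5_general {K : Type*} [Field K] [CharZero K] (p : K) (hp0 : p ≠ 0)
    (hp : ∀ k : ℕ, 0 < k → p ^ k ≠ 1) (n : ℕ) (hn : 2 ≤ n) (μ : Fin n → ℚ) (c : K) :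
    (∀ i : ℕ, 1 ≤ i → i ≤ n →
      SpVertex.qcomm 1 (SpVertex.vertexOp p n μ c) (SpVertex.Xplus p n i) = 0) ∧
    (∀ i : ℕ, 2 ≤ i → i ≤ n →
      SpVertex.qcomm 1 (SpVertex.vertexOp p n μ c) (SpVertex.Xminus p n i) = 0) ∧
    (SpVertex.qcomm (SpVertex.qpow p (-1 / 2)) (SpVertex.vertexOp p n μ c)
        (SpVertex.Xminus p n 1) =
      SpVertex.qpow p n • SpVertex.mulZdivW
        (SpVertex.qcomm (SpVertex.qpow p (1 / 2)) (SpVertex.vertexOp p n μ c)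
          (SpVertex.Xminus p n 1))) ∧
    (∀ r : ℚ,
      SpVertex.vertexOp p n μ c r * SpVertex.mode (SpVertex.Xminus p n 1) 1 -
          SpVertex.qpow p (-1 / 2) •
            (SpVertex.mode (SpVertex.Xminus p n 1) 1 * SpVertex.vertexOp p n μ c r) =
        SpVertex.qpow p n •
          (SpVertex.vertexOp p n μ c (r - 1) * SpVertex.mode (SpVertex.Xminus p n 1) 0 -
            SpVertex.qpow p (1 / 2) •
              (SpVertex.mode (SpVertex.Xminus p n 1) 0 * SpVertex.vertexOp p n μ c (r - 1)))) := by
  have hXminus_one := SpVertex.qcomm_vertexOp_Xminus_one hp0 hp hn μ c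
  refine ⟨fun i hi hin => ?_, fun i hi hin => SpVertex.qcomm_vertexOp_Xminus hp0 hp hn μ c hi hin,
    hXminus_one, fun r => ?_⟩
  · obtain rfl | hi := hi.eq_or_lt
    · exact SpVertex.qcomm_vertexOp_Xplus_one hp0 hp hn μ c
    · exact SpVertex.qcomm_vertexOp_Xplus hp0 hp hn μ c hi hin
  · have hmode := congrFun₂ hXminus_one r (-((1 : ℤ) : ℚ) - 1)
    have hexp : -((1 : ℤ) : ℚ) - 1 + 1 = -((0 : ℤ) : ℚ) - 1 := by norm_num
    simp only [Pi.smul_apply, SpVertex.mulZdivW, hexp] at hmode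
    exact hmode

theorem mainTheorem5 {K : Type*} [Field K] [CharZero K] (p : K) (hp0 : p ≠ 0)
    (hp : ∀ k : ℕ, 0 < k → p ^ k ≠ 1) (n : ℕ) (hn : 2 ≤ n) (ι : Fin 4) (c : K) :
    (∀ i : ℕ, 1 ≤ i → i ≤ n →
      SpVertex.qcomm 1 (SpVertex.PhiBar1 p n ι c) (SpVertex.Xplus p n i) = 0) ∧
    (∀ i : ℕ, 2 ≤ i → i ≤ n →
      SpVertex.qcomm 1 (SpVertex.PhiBar1 p n ι c) (SpVertex.Xminus p n i) = 0) ∧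
    (SpVertex.qcomm (SpVertex.qpow p (-1 / 2)) (SpVertex.PhiBar1 p n ι c)
        (SpVertex.Xminus p n 1) =
      SpVertex.qpow p n • SpVertex.mulZdivW
        (SpVertex.qcomm (SpVertex.qpow p (1 / 2)) (SpVertex.PhiBar1 p n ι c)
          (SpVertex.Xminus p n 1))) ∧
    (∀ r : ℚ,
      SpVertex.PhiBar1 p n ι c r * SpVertex.mode (SpVertex.Xminus p n 1) 1 -
          SpVertex.qpow p (-1 / 2) •
            (SpVertex.mode (SpVertex.Xminus p n 1) 1 * SpVertex.PhiBar1 p n ι c r) =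
        SpVertex.qpow p n •
          (SpVertex.PhiBar1 p n ι c (r - 1) * SpVertex.mode (SpVertex.Xminus p n 1) 0 -
            SpVertex.qpow p (1 / 2) •
              (SpVertex.mode (SpVertex.Xminus p n 1) 0 * SpVertex.PhiBar1 p n ι c (r - 1)))) :=
  mainTheorem5_general p hp0 hp n hn (SpVertex.mu n ι) c
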